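/- **Setting.** Let $\tilde{\mathbf X}$ be the space of symmetric positive definite real $3\times3$ matrices of determinant one, identified with $SL(3,\mathbb R)/SO(3)$, with the Riemannian metric $\tilde{\mathbf g}_A(V,W)=\mathrm{Tr}(A^{-1}VA^{-1}W)$. It is parametrized by pairs $(F,\omega)$, where $F=(f_{ij})$ is a symmetric positive definite $2\times2$ matrix and $\omega=(\omega_1,\omega_2)\in\mathbb R^2$, through $$\Phi=\begin{pmatrix} f^{-1} & -f^{-1}\omega_1 & -f^{-1}\omega_2\\ -f^{-1}\omega_1 & f_{11}+f^{-1}\omega_1^2 & f_{12}+f^{-1}\omega_1\omega_2\\ -f^{-1}\omega_2 & f_{12}+f^{-1}\omega_1\omega_2 & f_{22}+f^{-1}\omega_2^2\end{pmatrix},\qquad f=\det F .$$ The tension of a smooth map $\Phi$ from an open subset of Euclidean $\mathbb R^3$ to $\tilde{\mathbf X}$ is $\tau=\hat\nabla^\mu\partial_\mu\Phi=\Delta\Phi-\sum_\mu \partial_\mu\Phi\,\Phi^{-1}\partial_\mu\Phi$, where $\hat\nabla$ is induced by the Levi-Civita connection of $\tilde{\mathbf g}$, and $|\tau|=\tilde{\mathbf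 g}_\Phi(\tau,\tau)^{1/2}$. A *rod data set* $\mathcal D$ consists of points $z_1>\dots>z_L$ on the $z$-axis, which cut it into the closed rods $\Gamma_1=[z_1,\infty)$, $\Gamma_l=[z_l,z_{l-1}]$ for $2\le l\le L$, $\Gamma_{L+1}=(-\infty,z_L]$; of a rod structure $(m_l,n_l)\in\mathbb Z^2$ for each rod, which is $(0,0)$ for horizon rods and a pair of relatively prime integers for all other rods, called axis rods; and of a potential constant $\mathbf c_l\in\mathbb R^2$ for each axis rod. It is required that $\Gamma_1$ and $\Gamma_{L+1}$ have rod structures $(\pm1,0)$ and $(0,\pm1)$, or vice versa; that no two horizon rods are adjacent; and that at each *corner*, i.e. at each $z_l$ separating two axis rods $\Gamma_l$ and $\Gamma_{l+1}$, one has $$\delta_l:=\det\begin{pmatrix} m_l&n_l\\ m_{l+1}&n_{l+1}\end{pmatrix}\neq0\quad\text{and}\quad \mathbf c_l=\mathbf c_{l+1}.$$ Let $\Gamma\subset\mathbb R^3$ be the $z$-axis with the interiors of all horizon rods removed. The data satisfy the *generalized compatibility condition* if $m_{l-1}\,m_{l+1}\,\delta_{l-1}\,\delta_l\le0$ whenever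 $z_{l-1}$ and $z_l$ are both corners. **Theorem 5.1.** Let $\mathcal D$ be a rod data set satisfying the generalized compatibility condition. Then there is a model map for $\mathcal D$ with uniformly bounded tension of decay $O(r^{-7/2})$. That is, there is a smooth map $\Phi_0=(F,\omega):\mathbb R^3\setminus\Gamma\to\tilde{\mathbf X}$ with the following properties. 1. $\Phi_0$ respects $\mathcal D$: $F$ and $\omega$ extend continuously to $\mathbb R^3$, and for every axis rod $\Gamma_l$ the extensions satisfy $(m_l,n_l)\in\ker F$ and $\omega=\mathbf c_l$ at every point of $\Gamma_l$. Moreover $\ker F$ is exactly the line spanned by $(m_l,n_l)$ at every interior point of $\Gamma_l$. 2. Outside a large ball, $F$ is the matrix of Minkowski space: with $r=|x|$, it is $\mathrm{diag}\left(\tfrac{r-z}{2},\tfrac{r+z}{2}\right)$ if $\Gamma_1$ has rod structure $(\pm1,0)$, and $\mathrm{diag}\left(\tfrac{r+z}{2},\tfrac{r-z}{2}\right)$ if $\Gamma_1$ has rod structure $(0,\pm1)$. 3. There is a constant $C$ with $|\tau|\le C$ on $\mathbb R^3\setminus\Gamma$. 4. There are constants $C$ and $R>0$ with $|\tau(x)|\le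 C\,r^{-7/2}$ for all $x\in\mathbb R^3\setminus\Gamma$ with $r=|x|\ge R$. -/

import Mathlib

open scoped Matrix

noncomputable section

namespace RodModel

/-- Euclidean three-space with Cartesian coordinates `x 0`, `x 1`, `x 2`; the `z`-axis is
`x 0 = x 1 = 0`, and `x 2` is the height `z`. -/
abbrev E3 : Type := EuclideanSpace ℝ (Fin 3)

/-- The point of the `z`-axis at height `t`. -/
def axisPt (t : ℝ) : E3 := !₂[0, 0, t]

/-! ### The target -/

/-- The space of symmetric positive definite real `3 × 3` matrices of determinant one, which is
identified with `SL(3,ℝ)/SO(3)`. -/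
def Xtilde : Set (Matrix (Fin 3) (Fin 3) ℝ) := {A | A.PosDef ∧ A.det = 1}

/-- The invariant Riemannian metric `Tr(A⁻¹ V A⁻¹ W)` at the point `A`. -/
def metric (A V W : Matrix (Fin 3) (Fin 3) ℝ) : ℝ := (A⁻¹ * V * A⁻¹ * W).trace

/-- The Christoffel term of the Levi-Civita connection of `metric`, in the affine coordinates given
by the matrix entries: `∇_U V = D_U V + christoffel A U V`. The next two lemmas say that this
connection is torsion free and compatible with the metric. Covariant derivatives of tangent fields
of `Xtilde` (that is, `Tr(A⁻¹ V) = 0`) are again tangent to `Xtilde`, so it restricts to the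
Levi-Civita connection of `Xtilde`. -/
def christoffel (A U V : Matrix (Fin 3) (Fin 3) ℝ) : Matrix (Fin 3) (Fin 3) ℝ :=
  -((1 / 2 : ℝ) • (U * A⁻¹ * V + V * A⁻¹ * U))

theorem christoffel_symm (A U V : Matrix (Fin 3) (Fin 3) ℝ) :
    christoffel A U V = christoffel A V U := by
  unfold christoffel
  rw [add_comm]

section

attribute [local instance] Matrix.linftyOpNormedRing Matrix.linftyOpNormedAlgebra

theorem christoffel_metric (A U V W : Matrix (Fin 3) (Fin 3) ℝ) (hA : IsUnit A) :
    HasDerivAt (fun t : ℝ => metric (A + t • U) V W)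
      (metric A (christoffel A U V) W + metric A V (christoffel A U W)) 0 := by
  obtain ⟨a, rfl⟩ := hA
  have h1 : HasDerivAt (fun t : ℝ => (a : Matrix (Fin 3) (Fin 3) ℝ) + t • U) U 0 := by
    have h := ((hasDerivAt_id (0 : ℝ)).smul_const U).const_add (a : Matrix (Fin 3) (Fin 3) ℝ)
    rw [one_smul] at h
    exact h
  have h2 : HasDerivAt (fun t : ℝ => ((a : Matrix (Fin 3) (Fin 3) ℝ) + t • U)⁻¹)
      (-((a : Matrix (Fin 3) (Fin 3) ℝ)⁻¹ * U * (a : Matrix (Fin 3) (Fin 3) ℝ)⁻¹)) 0 := by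
    have h0 : HasFDerivAt Ring.inverse
        (-ContinuousLinearMap.mulLeftRight ℝ (Matrix (Fin 3) (Fin 3) ℝ) ↑a⁻¹ ↑a⁻¹)
        ((a : Matrix (Fin 3) (Fin 3) ℝ) + (0 : ℝ) • U) := by
      simpa using hasFDerivAt_ringInverse (𝕜 := ℝ) a
    have h3 := h0.comp_hasDerivAt (0 : ℝ) h1
    have e : (fun t : ℝ => ((a : Matrix (Fin 3) (Fin 3) ℝ) + t • U)⁻¹) =
        Ring.inverse ∘ fun t : ℝ => (a : Matrix (Fin 3) (Fin 3) ℝ) + t • U := by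
      funext t
      simp [Matrix.nonsing_inv_eq_ringInverse]
    rw [e]
    refine h3.congr_deriv ?_
    simp [Matrix.coe_units_inv]
  have h4 := ((h2.mul_const V).mul h2).mul_const W
  have h5 := (LinearMap.toContinuousLinearMap
    (Matrix.traceLinearMap (Fin 3) ℝ ℝ)).hasFDerivAt.comp_hasDerivAt (0 : ℝ) h4
  refine h5.congr_deriv ?_
  change Matrix.trace (_ : Matrix (Fin 3) (Fin 3) ℝ) = (_ : ℝ)
  simp only [zero_smul, add_zero, metric, christoffel]
  generalize (a : Matrix (Fin 3) (Fin 3) ℝ)⁻¹ = B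
  have c1 : (B * V * (B * (U * B * W))).trace = (B * W * (B * V * (B * U))).trace := by
    rw [Matrix.trace_mul_comm (B * W)]
    congr 1
    noncomm_ring
  have c2 : (B * V * (B * (W * B * U))).trace = (B * (U * B * V) * B * W).trace := by
    rw [show B * V * (B * (W * B * U)) = (B * V * B * W) * (B * U) by noncomm_ring,
      Matrix.trace_mul_comm]
    congr 1
    noncomm_ring
  have c3 : (B * V * (B * (U * B * W))).trace = (B * V * B * (U * B * W)).trace := by
    congr 1
    noncomm_ring
  simp only [mul_add, add_mul, mul_neg, neg_mul, Matrix.trace_add, Matrix.trace_neg,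
    Matrix.mul_smul, Matrix.smul_mul, Matrix.trace_smul, smul_eq_mul, mul_assoc] at *
  linarith

end

/-! ### Maps from three-space to the target, and their tension -/

/-- The partial derivative of a matrix valued map in the `k`-th coordinate direction. -/
def pderiv (k : Fin 3) (Φ : E3 → Matrix (Fin 3) (Fin 3) ℝ) (x : E3) :
    Matrix (Fin 3) (Fin 3) ℝ :=
  Matrix.of fun i j => fderiv ℝ (fun y => Φ y i j) x (EuclideanSpace.single k 1)

/-- The tension field: the trace over the flat metric of `ℝ³` of the covariant derivative (induced
by the Levi-Civita connection of the target) of the differential of `Φ`. -/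
def tension (Φ : E3 → Matrix (Fin 3) (Fin 3) ℝ) (x : E3) : Matrix (Fin 3) (Fin 3) ℝ :=
  ∑ k : Fin 3,
    (pderiv k (pderiv k Φ) x + christoffel (Φ x) (pderiv k Φ x) (pderiv k Φ x))

/-- The norm `|τ|` of the tension field in the metric of the target. -/
def tensionNorm (Φ : E3 → Matrix (Fin 3) (Fin 3) ℝ) (x : E3) : ℝ :=
  Real.sqrt (metric (Φ x) (tension Φ x) (tension Φ x))

/-- The parametrization of `Xtilde` by a symmetric positive definite `2 × 2` matrix `F = (f_ij)`
and a vector `ω`; here `f = det F`. -/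
def param (F : Matrix (Fin 2) (Fin 2) ℝ) (ω : Fin 2 → ℝ) : Matrix (Fin 3) (Fin 3) ℝ :=
  !![F.det⁻¹, -(F.det⁻¹ * ω 0), -(F.det⁻¹ * ω 1);
     -(F.det⁻¹ * ω 0), F 0 0 + F.det⁻¹ * ω 0 * ω 0, F 0 1 + F.det⁻¹ * ω 0 * ω 1;
     -(F.det⁻¹ * ω 1), F 0 1 + F.det⁻¹ * ω 0 * ω 1, F 1 1 + F.det⁻¹ * ω 1 * ω 1]

/-! ### Rod data -/

/-- A rod data set. The points `z 0 > z 1 > ⋯ > z (L - 1)` cut the `z`-axis into `L + 1` rods,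
numbered from the top: `[z 0, ∞)`, `[z 1, z 0]`, …, `(-∞, z (L - 1)]`. The rod `l` has rod structure
`(m l, n l)`; it is `(0, 0)` exactly for the horizon rods, all other rods being axis rods.
The point `z i` separates the rods `i.castSucc` (above) and `i.succ` (below). -/
structure RodData where
  /-- the number of corners and poles -/
  L : ℕ
  /-- the heights of the corners and poles -/
  z : Fin L → ℝ
  z_strictAnti : StrictAnti z
  /-- first components of the rod structures -/
  m : Fin (L + 1) → ℤ
  /-- second components of the rod structures -/
  n : Fin (L + 1) → ℤ
  /-- the potential constants; the values on horizon rods carry no meaning and are never used -/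
  c : Fin (L + 1) → Fin 2 → ℝ
  /-- the rod structure of an axis rod is a pair of relatively prime integers -/
  coprime : ∀ l, ¬ (m l = 0 ∧ n l = 0) → IsCoprime (m l) (n l)
  /-- the two semi-infinite rods have rod structures `(±1, 0)` and `(0, ±1)` or vice versa -/
  ends : (|m 0| = 1 ∧ n 0 = 0 ∧ m (Fin.last L) = 0 ∧ |n (Fin.last L)| = 1) ∨
    (m 0 = 0 ∧ |n 0| = 1 ∧ |m (Fin.last L)| = 1 ∧ n (Fin.last L) = 0)
  /-- every `z i` is a corner or a pole: it does not separate two horizon rods -/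
  corner_or_pole : ∀ i : Fin L,
    ¬ (m i.castSucc = 0 ∧ n i.castSucc = 0) ∨ ¬ (m i.succ = 0 ∧ n i.succ = 0)
  /-- the rod structures on the two sides of a corner are linearly independent -/
  corner_det : ∀ i : Fin L,
    ¬ (m i.castSucc = 0 ∧ n i.castSucc = 0) → ¬ (m i.succ = 0 ∧ n i.succ = 0) →
      m i.castSucc * n i.succ - n i.castSucc * m i.succ ≠ 0
  /-- the potential constants do not change at a corner -/
  corner_const : ∀ i : Fin L,
    ¬ (m i.castSucc = 0 ∧ n i.castSucc = 0) → ¬ (m i.succ = 0 ∧ n i.succ = 0) →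
      c i.castSucc = c i.succ

namespace RodData

variable (D : RodData)

/-- The rod `l` is an axis rod, i.e. not a horizon rod. -/
def IsAxis (l : Fin (D.L + 1)) : Prop := ¬ (D.m l = 0 ∧ D.n l = 0)

/-- The rod structure as a real vector. -/
def dir (l : Fin (D.L + 1)) : Fin 2 → ℝ := ![(D.m l : ℝ), (D.n l : ℝ)]

/-- The rod `l` as a closed interval of heights. -/
def rod (l : Fin (D.L + 1)) : Set ℝ :=
  {t | (∀ i : Fin D.L, i.castSucc < l → t ≤ D.z i) ∧ ∀ i : Fin D.L, l ≤ i.castSucc → D.z i ≤ t}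

/-- The interior of the rod `l`. -/
def openRod (l : Fin (D.L + 1)) : Set ℝ :=
  {t | (∀ i : Fin D.L, i.castSucc < l → t < D.z i) ∧ ∀ i : Fin D.L, l ≤ i.castSucc → D.z i < t}

/-- The set `Γ`: the `z`-axis with the interiors of all horizon rods removed. -/
def Gam : Set E3 :=
  {x | x 0 = 0 ∧ x 1 = 0 ∧ ∀ l : Fin (D.L + 1), ¬ D.IsAxis l → x 2 ∉ D.openRod l}

/-- `z i` is a corner: it separates two axis rods. -/
def IsCorner (i : Fin D.L) : Prop := D.IsAxis i.castSucc ∧ D.IsAxis i.succ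

/-- The determinant of the two rod structures adjacent to `z i`, the upper one in the first row. -/
def cornerDet (i : Fin D.L) : ℤ :=
  Matrix.det !![D.m i.castSucc, D.n i.castSucc; D.m i.succ, D.n i.succ]

/-- The generalized compatibility condition, imposed whenever `z i` and the next point `z j` below
it are both corners. -/
def GeneralizedCompatibility : Prop :=
  ∀ i j : Fin D.L, (j : ℕ) = (i : ℕ) + 1 → D.IsCorner i → D.IsCorner j →
    D.m i.castSucc * D.m j.succ * D.cornerDet i * D.cornerDet j ≤ 0

/-- `(F, ω)`, continuous up to `Γ`, respects the rod data set: on each closed axis rod the rod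
structure lies in the kernel of `F` and `ω` equals the potential constant. Moreover, in the interior
of the rod no other direction degenerates: the kernel of `F` is the line spanned by the
rod structure. -/
def Respects (F : E3 → Matrix (Fin 2) (Fin 2) ℝ) (ω : E3 → Fin 2 → ℝ) : Prop :=
  Continuous F ∧ Continuous ω ∧ ∀ l, D.IsAxis l →
    (∀ t ∈ D.rod l, F (axisPt t) *ᵥ D.dir l = 0 ∧ ω (axisPt t) = D.c l) ∧
    ∀ t ∈ D.openRod l, ∀ v : Fin 2 → ℝ, F (axisPt t) *ᵥ v = 0 → ∃ s : ℝ, v = s • D.dir l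

/-- The matrix `F` of Minkowski space in Weyl-Papapetrou coordinates, with the rotational Killing
fields labelled as on the semi-infinite rods. If these have rod structures `(±1, 0)` (north) and
`(0, ±1)` (south), it is `diag((r - z)/2, (r + z)/2)`; in the opposite case the diagonal entries
are interchanged. -/
def minkowski (x : E3) : Matrix (Fin 2) (Fin 2) ℝ :=
  ((‖x‖ - x 2) / 2) • Matrix.vecMulVec (D.dir 0) (D.dir 0) +
    ((‖x‖ + x 2) / 2) • Matrix.vecMulVec (D.dir (Fin.last D.L)) (D.dir (Fin.last D.L))

/-- A model map for the rod data set `D`: a smooth map from the complement of `Γ` to `Xtilde` such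
that `Φ = (F, ω)` respects `D` and has the fiber metric of Minkowski space outside a large ball. The
functions `F` and `ω` are defined on all of `ℝ³`, their values on `Γ` being boundary values. The
values of `Φ` on `Γ` are irrelevant. -/
def IsModelMap (Φ : E3 → Matrix (Fin 3) (Fin 3) ℝ) : Prop :=
  (∀ i j, ContDiffOn ℝ ((⊤ : ℕ∞) : WithTop ℕ∞) (fun x => Φ x i j) D.Gamᶜ) ∧
  (∀ x ∈ D.Gamᶜ, Φ x ∈ Xtilde) ∧
  ∃ (F : E3 → Matrix (Fin 2) (Fin 2) ℝ) (ω : E3 → Fin 2 → ℝ),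
    (∀ x ∈ D.Gamᶜ, (F x).PosDef ∧ Φ x = param (F x) (ω x)) ∧
    D.Respects F ω ∧
    ∃ R : ℝ, ∀ x : E3, R ≤ ‖x‖ → F x = D.minkowski x

end RodData

end RodModel

end

open scoped Topology Manifold

noncomputable section

namespace RodModel

/-! ### Partial derivatives of scalar functions -/

/-! The map is glued from explicit pieces by a partition of unity on `ℝ³`. The piece centred at `z
i` is `g ξξᵀ + h ηηᵀ` with constant independent vectors: `ξ` is perpendicular to the direction
degenerating below `z i`, `η` to the one degenerating above. The coefficients are `(r - (z - z
i))/2` and `(r + (z - z i))/2`, with `r` the distance to the centre, except that the coefficient of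
a horizon side is replaced by `1`. These functions have harmonic logarithms, so with constant `ω`
the piece is a harmonic map into a maximal flat (`tensionNorm_param_eq_zero`). One further piece,
centred at the origin, is the Minkowski matrix; it alone is active outside a large ball.

The region of a piece meets only the rods adjacent to its centre, each on the correct side
(`rod_of_mem_region`). Hence all pieces active at a point of an axis rod kill the same vector. Since
positive semidefinite forms, and those with a prescribed kernel, form convex cones, the glued `F` is
positive definite off `Γ` (`posDef_F`) and has exactly the prescribed kernel inside each axis rod
(`ker_F`).

Gluing destroys harmonicity, but only bounds are needed, and they are local. Off `Γ` the tension is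
continuous. Near each `z i` a single piece is active and `ω` is constant, so the tension is zero.
Near an interior point of an axis rod, `F` has the shape `AdaptedAt`, which survives gluing: the
singular part of the logarithm of its small eigenvalue is the harmonic function `log ρ²`, and the
only remaining singular term carries the weight `ρ²` (`tensionNorm_sq_le_axisBound`). Compactness
gives a bound on every ball.

Far out only `ω` deviates from a harmonic map: it interpolates between the two end constants as a
function of the polar angle alone, and only in the sector `|cos θ| ≤ 1/2`. There `F` is comparable
to `r` times the identity. The equation for `ω` contributes `r⁻³ · (r⁻²)²` to the squared tension
and all other terms are smaller, whence the rate `r^(-7/2)` (`exists_tensionNorm_decay`).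

All computations go through one formula, `tensionNorm_sq_eq`, for the tension in horospherical
coordinates after a constant congruence. -/

/-- The `k`-th partial derivative of a scalar function. -/
def pd (k : Fin 3) (u : E3 → ℝ) (x : E3) : ℝ := fderiv ℝ u x (EuclideanSpace.single k 1)

/-- The second partial derivative in the `k`-th direction. -/
def pdd (k : Fin 3) (u : E3 → ℝ) (x : E3) : ℝ := pd k (pd k u) x

theorem pd_congr {k : Fin 3} {u v : E3 → ℝ} {x : E3} (h : u =ᶠ[𝓝 x] v) :
    pd k u =ᶠ[𝓝 x] pd k v :=
  (h.fderiv (𝕜 := ℝ)).mono fun y hy => by simp only [pd, hy]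

theorem pd_congr_at {k : Fin 3} {u v : E3 → ℝ} {x : E3} (h : u =ᶠ[𝓝 x] v) :
    pd k u x = pd k v x := (pd_congr h).eq_of_nhds

theorem pdd_congr_at {k : Fin 3} {u v : E3 → ℝ} {x : E3} (h : u =ᶠ[𝓝 x] v) :
    pdd k u x = pdd k v x := pd_congr_at (pd_congr h)

theorem _root_.ContDiffAt.partial_deriv {k : Fin 3} {u : E3 → ℝ} {x : E3} {m n : WithTop ℕ∞}
    (h : ContDiffAt ℝ n u x) (hmn : m + 1 ≤ n) : ContDiffAt ℝ m (pd k u) x :=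
  (h.fderiv_right hmn).clm_apply contDiffAt_const

theorem _root_.ContDiffAt.eventually_two {u : E3 → ℝ} {x : E3} (h : ContDiffAt ℝ 2 u x) :
    ∀ᶠ y in 𝓝 x, ContDiffAt ℝ 2 u y := h.eventually (by simp)

theorem _root_.ContDiffAt.dAt {u : E3 → ℝ} {x : E3} (h : ContDiffAt ℝ 2 u x) :
    DifferentiableAt ℝ u x := h.differentiableAt (by simp)

theorem _root_.ContDiffAt.pd_dAt {k : Fin 3} {u : E3 → ℝ} {x : E3} (h : ContDiffAt ℝ 2 u x) :
    DifferentiableAt ℝ (pd k u) x :=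
  (h.partial_deriv (m := 1) (by norm_num)).differentiableAt (by simp)

theorem pd_const {k : Fin 3} (c : ℝ) (x : E3) : pd k (fun _ => c) x = 0 := by
  simp [pd]

theorem pd_add {k : Fin 3} {u v : E3 → ℝ} {x : E3} (hu : DifferentiableAt ℝ u x)
    (hv : DifferentiableAt ℝ v x) : pd k (fun y => u y + v y) x = pd k u x + pd k v x := by
  simp [pd, fderiv_fun_add hu hv]

theorem pd_mul {k : Fin 3} {u v : E3 → ℝ} {x : E3} (hu : DifferentiableAt ℝ u x)
    (hv : DifferentiableAt ℝ v x) :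
    pd k (fun y => u y * v y) x = pd k u x * v x + u x * pd k v x := by
  simp [pd, fderiv_fun_mul hu hv]; ring

theorem pd_const_mul {k : Fin 3} {u : E3 → ℝ} {x : E3} (c : ℝ) (hu : DifferentiableAt ℝ u x) :
    pd k (fun y => c * u y) x = c * pd k u x := by
  rw [pd_mul (differentiableAt_const c) hu, pd_const]; ring

theorem pd_sum {ι : Type*} {k : Fin 3} {s : Finset ι} {u : ι → E3 → ℝ} {x : E3}
    (hu : ∀ i ∈ s, DifferentiableAt ℝ (u i) x) :
    pd k (fun y => ∑ i ∈ s, u i y) x = ∑ i ∈ s, pd k (u i) x := by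
  simp [pd, fderiv_fun_sum hu]

theorem pd_comp {k : Fin 3} {φ : ℝ → ℝ} {u : E3 → ℝ} {x : E3} {φ' : ℝ}
    (hφ : HasDerivAt φ φ' (u x)) (hu : DifferentiableAt ℝ u x) :
    pd k (fun y => φ (u y)) x = φ' * pd k u x := by
  have := (hφ.comp_hasFDerivAt x hu.hasFDerivAt).fderiv
  simp only [pd]
  rw [show (fun y => φ (u y)) = φ ∘ u from rfl, this]
  simp

theorem pdd_const {k : Fin 3} (c : ℝ) (x : E3) : pdd k (fun _ => c) x = 0 := by
  have : pd k (fun _ => c) = fun _ => 0 := funext fun y => pd_const c y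
  rw [pdd, this, pd_const]

theorem pdd_add {k : Fin 3} {u v : E3 → ℝ} {x : E3} (hu : ContDiffAt ℝ 2 u x)
    (hv : ContDiffAt ℝ 2 v x) : pdd k (fun y => u y + v y) x = pdd k u x + pdd k v x := by
  have h : pd k (fun y => u y + v y) =ᶠ[𝓝 x] fun y => pd k u y + pd k v y := by
    filter_upwards [hu.eventually_two, hv.eventually_two] with y h1 h2
    exact pd_add h1.dAt h2.dAt
  rw [pdd, pd_congr_at h, pd_add hu.pd_dAt hv.pd_dAt]; rfl

theorem pdd_mul {k : Fin 3} {u v : E3 → ℝ} {x : E3} (hu : ContDiffAt ℝ 2 u x)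
    (hv : ContDiffAt ℝ 2 v x) : pdd k (fun y => u y * v y) x =
      pdd k u x * v x + 2 * (pd k u x * pd k v x) + u x * pdd k v x := by
  have h : pd k (fun y => u y * v y) =ᶠ[𝓝 x] fun y => pd k u y * v y + u y * pd k v y := by
    filter_upwards [hu.eventually_two, hv.eventually_two] with y h1 h2
    exact pd_mul h1.dAt h2.dAt
  rw [pdd, pd_congr_at h, pd_add (hu.pd_dAt.fun_mul hv.dAt) (hu.dAt.fun_mul hv.pd_dAt),
    pd_mul hu.pd_dAt hv.dAt, pd_mul hu.dAt hv.pd_dAt]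
  simp only [pdd]; ring

theorem pdd_const_mul {k : Fin 3} {u : E3 → ℝ} {x : E3} (c : ℝ) (hu : ContDiffAt ℝ 2 u x) :
    pdd k (fun y => c * u y) x = c * pdd k u x := by
  rw [pdd_mul contDiffAt_const hu, pd_const, pdd_const]; ring

theorem pdd_sum {ι : Type*} {k : Fin 3} {s : Finset ι} {u : ι → E3 → ℝ} {x : E3}
    (hu : ∀ i ∈ s, ContDiffAt ℝ 2 (u i) x) :
    pdd k (fun y => ∑ i ∈ s, u i y) x = ∑ i ∈ s, pdd k (u i) x := by
  have h : pd k (fun y => ∑ i ∈ s, u i y) =ᶠ[𝓝 x] fun y => ∑ i ∈ s, pd k (u i) y := by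
    have : ∀ᶠ y in 𝓝 x, ∀ i ∈ s, ContDiffAt ℝ 2 (u i) y :=
      (Filter.eventually_all_finset s).2 fun i hi => (hu i hi).eventually_two
    filter_upwards [this] with y hy
    exact pd_sum fun i hi => (hy i hi).dAt
  rw [pdd, pd_congr_at h, pd_sum fun i hi => (hu i hi).pd_dAt]; rfl

theorem pdd_comp {k : Fin 3} {φ φ' : ℝ → ℝ} {u : E3 → ℝ} {x : E3} {φ'' : ℝ}
    (hφ : ∀ᶠ t in 𝓝 (u x), HasDerivAt φ (φ' t) t) (hφ' : HasDerivAt φ' φ'' (u x))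
    (hu : ContDiffAt ℝ 2 u x) :
    pdd k (fun y => φ (u y)) x = φ'' * pd k u x ^ 2 + φ' (u x) * pdd k u x := by
  have h : pd k (fun y => φ (u y)) =ᶠ[𝓝 x] fun y => φ' (u y) * pd k u y := by
    filter_upwards [hu.eventually_two, hu.continuousAt.eventually hφ] with y h1 h2
    exact pd_comp h2 h1.dAt
  rw [pdd, pd_congr_at h, pd_mul (u := fun y => φ' (u y)) (hφ'.differentiableAt.comp x hu.dAt) hu.pd_dAt,
    pd_comp hφ' hu.dAt]
  simp only [pdd]; ring

theorem pd_exp {k : Fin 3} {u : E3 → ℝ} {x : E3} (hu : ContDiffAt ℝ 2 u x) :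
    pd k (fun y => Real.exp (u y)) x = Real.exp (u x) * pd k u x :=
  pd_comp (Real.hasDerivAt_exp _) hu.dAt

theorem pdd_exp {k : Fin 3} {u : E3 → ℝ} {x : E3} (hu : ContDiffAt ℝ 2 u x) :
    pdd k (fun y => Real.exp (u y)) x = Real.exp (u x) * (pdd k u x + pd k u x ^ 2) := by
  rw [pdd_comp (Filter.Eventually.of_forall Real.hasDerivAt_exp) (Real.hasDerivAt_exp _) hu]
  ring

theorem pd_log {k : Fin 3} {u : E3 → ℝ} {x : E3} (hu : ContDiffAt ℝ 2 u x) (h0 : u x ≠ 0) :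
    pd k (fun y => Real.log (u y)) x = pd k u x / u x := by
  rw [pd_comp (Real.hasDerivAt_log h0) hu.dAt]; ring

theorem pdd_log {k : Fin 3} {u : E3 → ℝ} {x : E3} (hu : ContDiffAt ℝ 2 u x) (h0 : u x ≠ 0) :
    pdd k (fun y => Real.log (u y)) x = pdd k u x / u x - pd k u x ^ 2 / u x ^ 2 := by
  rw [pdd_comp (φ' := fun t => t⁻¹) (φ'' := -(u x ^ 2)⁻¹) ?_ (hasDerivAt_inv h0) hu]
  · field_simp; ring
  · filter_upwards [isOpen_ne.mem_nhds h0] with t ht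
    exact Real.hasDerivAt_log ht

/-! ### Congruences of matrix valued maps -/

/-- All entries of a matrix valued map are twice continuously differentiable at a point. -/
def C2At (Φ : E3 → Matrix (Fin 3) (Fin 3) ℝ) (x : E3) : Prop :=
  ∀ i j, ContDiffAt ℝ 2 (fun y => Φ y i j) x

theorem pderiv_apply (k : Fin 3) (Φ : E3 → Matrix (Fin 3) (Fin 3) ℝ) (x : E3) (i j : Fin 3) :
    pderiv k Φ x i j = pd k (fun y => Φ y i j) x := rfl

theorem pderiv_pderiv_apply (k : Fin 3) (Φ : E3 → Matrix (Fin 3) (Fin 3) ℝ) (x : E3)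
    (i j : Fin 3) : pderiv k (pderiv k Φ) x i j = pdd k (fun y => Φ y i j) x := rfl

theorem tension_congr {Φ Ψ : E3 → Matrix (Fin 3) (Fin 3) ℝ} {x : E3} (h : Φ =ᶠ[𝓝 x] Ψ) :
    tension Φ x = tension Ψ x := by
  have he : ∀ i j, (fun y => Φ y i j) =ᶠ[𝓝 x] fun y => Ψ y i j := fun i j =>
    h.mono fun y hy => by simp only [hy]
  have h1 : ∀ k, pderiv k Φ x = pderiv k Ψ x := fun k => by
    ext i j; exact pd_congr_at (he i j)
  have h2 : ∀ k, pderiv k (pderiv k Φ) x = pderiv k (pderiv k Ψ) x := fun k => by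
    ext i j; exact pdd_congr_at (he i j)
  simp only [tension, h1, h2, h.eq_of_nhds]

theorem tensionNorm_congr {Φ Ψ : E3 → Matrix (Fin 3) (Fin 3) ℝ} {x : E3} (h : Φ =ᶠ[𝓝 x] Ψ) :
    tensionNorm Φ x = tensionNorm Ψ x := by
  rw [tensionNorm, tensionNorm, tension_congr h, h.eq_of_nhds]

theorem congr_entry (G M : Matrix (Fin 3) (Fin 3) ℝ) (i j : Fin 3) :
    (Gᵀ * M * G) i j = ∑ b, ∑ a, (G a i * G b j) * M a b := by
  simp only [Matrix.mul_apply, Matrix.transpose_apply, Finset.sum_mul]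
  exact Finset.sum_congr rfl fun b _ => Finset.sum_congr rfl fun a _ => by ring

/-- A constant congruence is linear in the matrix entries and preserves the connection, so it
commutes with taking the tension. -/
theorem tension_conj (G : Matrix (Fin 3) (Fin 3) ℝ) (hG : IsUnit G.det)
    {Ψ : E3 → Matrix (Fin 3) (Fin 3) ℝ} {x : E3} (hΨ : C2At Ψ x) :
    tension (fun y => Gᵀ * Ψ y * G) x = Gᵀ * tension Ψ x * G := by
  have h1 : ∀ k, pderiv k (fun y => Gᵀ * Ψ y * G) x = Gᵀ * pderiv k Ψ x * G := fun k => by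
    ext i j
    have hd : ∀ a b, DifferentiableAt ℝ (fun y => Ψ y a b) x := fun a b => (hΨ a b).dAt
    rw [pderiv_apply, congr_entry]
    simp only [congr_entry]
    rw [pd_sum fun b _ => DifferentiableAt.fun_sum fun a _ => (hd a b).const_mul _]
    refine Finset.sum_congr rfl fun b _ => ?_
    rw [pd_sum fun a _ => (hd a b).const_mul _]
    exact Finset.sum_congr rfl fun a _ => pd_const_mul _ (hd a b)
  have h2 : ∀ k, pderiv k (pderiv k (fun y => Gᵀ * Ψ y * G)) x =
      Gᵀ * pderiv k (pderiv k Ψ) x * G := fun k => by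
    ext i j
    rw [pderiv_pderiv_apply, congr_entry]
    simp only [congr_entry]
    rw [pdd_sum fun b _ => ContDiffAt.sum fun a _ => contDiffAt_const.mul (hΨ a b)]
    refine Finset.sum_congr rfl fun b _ => ?_
    rw [pdd_sum fun a _ => contDiffAt_const.mul (hΨ a b)]
    exact Finset.sum_congr rfl fun a _ => pdd_const_mul _ (hΨ a b)
  have hGt : IsUnit Gᵀ.det := by rwa [Matrix.det_transpose]
  have h3 : ∀ U A : Matrix (Fin 3) (Fin 3) ℝ,
      (Gᵀ * U * G) * (Gᵀ * A * G)⁻¹ * (Gᵀ * U * G) = Gᵀ * (U * A⁻¹ * U) * G := fun U A => by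
    rw [Matrix.mul_inv_rev, Matrix.mul_inv_rev]
    calc _ = Gᵀ * U * (G * G⁻¹) * A⁻¹ * (Gᵀ⁻¹ * Gᵀ) * U * G := by noncomm_ring
      _ = _ := by
        rw [Matrix.mul_nonsing_inv _ hG, Matrix.nonsing_inv_mul _ hGt]; noncomm_ring
  simp only [tension, christoffel, h1, h2, h3, Finset.mul_sum, Finset.sum_mul]
  refine Finset.sum_congr rfl fun k _ => ?_
  simp only [mul_add, add_mul, smul_add, Matrix.mul_smul, Matrix.smul_mul, Matrix.mul_neg,
    Matrix.neg_mul, neg_add]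

theorem metric_conj (G : Matrix (Fin 3) (Fin 3) ℝ) (hG : IsUnit G.det)
    (A V W : Matrix (Fin 3) (Fin 3) ℝ) :
    metric (Gᵀ * A * G) (Gᵀ * V * G) (Gᵀ * W * G) = metric A V W := by
  have hGt : IsUnit Gᵀ.det := by rwa [Matrix.det_transpose]
  rw [metric, Matrix.mul_inv_rev, Matrix.mul_inv_rev]
  have : G⁻¹ * (A⁻¹ * Gᵀ⁻¹) * (Gᵀ * V * G) * (G⁻¹ * (A⁻¹ * Gᵀ⁻¹)) * (Gᵀ * W * G) =
      G⁻¹ * (A⁻¹ * V * A⁻¹ * W * G) := by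
    calc _ = G⁻¹ * A⁻¹ * (Gᵀ⁻¹ * Gᵀ) * V * (G * G⁻¹) * A⁻¹ * (Gᵀ⁻¹ * Gᵀ) * W * G := by
          noncomm_ring
      _ = _ := by
        rw [Matrix.mul_nonsing_inv _ hG, Matrix.nonsing_inv_mul _ hGt]; noncomm_ring
  rw [this, Matrix.trace_mul_comm, Matrix.mul_assoc, Matrix.mul_nonsing_inv _ hG, Matrix.mul_one,
    metric]

theorem tensionNorm_conj (G : Matrix (Fin 3) (Fin 3) ℝ) (hG : IsUnit G.det)
    {Ψ : E3 → Matrix (Fin 3) (Fin 3) ℝ} {x : E3} (hΨ : C2At Ψ x) :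
    tensionNorm (fun y => Gᵀ * Ψ y * G) x = tensionNorm Ψ x := by
  rw [tensionNorm, tension_conj G hG hΨ, metric_conj G hG, tensionNorm]

/-! ### The tension in horospherical coordinates -/

/-- The matrix `Nᵀ D N` with `D = diag (exp u₀, exp u₁, exp u₂)` and `N` the unipotent matrix whose
first row is `(1, a, b)`. -/
def horo (u₀ u₁ u₂ a b : ℝ) : Matrix (Fin 3) (Fin 3) ℝ :=
  !![Real.exp u₀, Real.exp u₀ * a, Real.exp u₀ * b;
     Real.exp u₀ * a, Real.exp u₁ + Real.exp u₀ * (a * a), Real.exp u₀ * (a * b);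
     Real.exp u₀ * b, Real.exp u₀ * (a * b), Real.exp u₂ + Real.exp u₀ * (b * b)]

/-- The Laplacian. -/
def lap (u : E3 → ℝ) (x : E3) : ℝ := ∑ k, pdd k u x

/-- The inner product of two gradients. -/
def gradInner (u v : E3 → ℝ) (x : E3) : ℝ := ∑ k, pd k u x * pd k v x

/-- The squared norm of the tension of `horo u₀ u₁ u₂ a b`. -/
def horoTensionSq (u₀ u₁ u₂ a b : E3 → ℝ) (x : E3) : ℝ :=
  (lap u₀ x - Real.exp (u₀ x - u₁ x) * gradInner a a x -
      Real.exp (u₀ x - u₂ x) * gradInner b b x) ^ 2 +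
    (lap u₁ x + Real.exp (u₀ x - u₁ x) * gradInner a a x) ^ 2 +
    (lap u₂ x + Real.exp (u₀ x - u₂ x) * gradInner b b x) ^ 2 +
    2 * Real.exp (u₀ x - u₁ x) *
      (lap a x + gradInner a u₀ x - gradInner a u₁ x) ^ 2 +
    2 * Real.exp (u₀ x - u₂ x) *
      (lap b x + gradInner b u₀ x - gradInner b u₂ x) ^ 2 +
    2 * (Real.exp (u₀ x - u₁ x) * Real.exp (u₀ x - u₂ x)) * gradInner a b x ^ 2

theorem c2At_horo {u₀ u₁ u₂ a b : E3 → ℝ} {x : E3} (h₀ : ContDiffAt ℝ 2 u₀ x)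
    (h₁ : ContDiffAt ℝ 2 u₁ x) (h₂ : ContDiffAt ℝ 2 u₂ x) (ha : ContDiffAt ℝ 2 a x)
    (hb : ContDiffAt ℝ 2 b x) :
    C2At (fun y => horo (u₀ y) (u₁ y) (u₂ y) (a y) (b y)) x := by
  intro i j
  have e₀ := h₀.exp
  have e₁ := h₁.exp
  have e₂ := h₂.exp
  fin_cases i <;> fin_cases j <;> simp [horo] <;> fun_prop

theorem pd_exp_mul {k : Fin 3} {u a : E3 → ℝ} {x : E3} (hu : ContDiffAt ℝ 2 u x)
    (ha : ContDiffAt ℝ 2 a x) (ha0 : a x = 0) :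
    pd k (fun y => Real.exp (u y) * a y) x = Real.exp (u x) * pd k a x := by
  rw [pd_mul hu.exp.dAt ha.dAt, ha0]; ring

theorem pdd_exp_mul {k : Fin 3} {u a : E3 → ℝ} {x : E3} (hu : ContDiffAt ℝ 2 u x)
    (ha : ContDiffAt ℝ 2 a x) (ha0 : a x = 0) :
    pdd k (fun y => Real.exp (u y) * a y) x =
      Real.exp (u x) * (pdd k a x + 2 * (pd k u x * pd k a x)) := by
  rw [pdd_mul hu.exp ha, pd_exp hu, ha0]; ring

theorem pd_exp_mul_mul {k : Fin 3} {u a b : E3 → ℝ} {x : E3} (hu : ContDiffAt ℝ 2 u x)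
    (ha : ContDiffAt ℝ 2 a x) (hb : ContDiffAt ℝ 2 b x) (ha0 : a x = 0) (hb0 : b x = 0) :
    pd k (fun y => Real.exp (u y) * (a y * b y)) x = 0 := by
  rw [pd_exp_mul hu (ha.mul hb) (by simp [ha0]), pd_mul ha.dAt hb.dAt, ha0, hb0]; ring

theorem pdd_exp_mul_mul {k : Fin 3} {u a b : E3 → ℝ} {x : E3} (hu : ContDiffAt ℝ 2 u x)
    (ha : ContDiffAt ℝ 2 a x) (hb : ContDiffAt ℝ 2 b x) (ha0 : a x = 0) (hb0 : b x = 0) :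
    pdd k (fun y => Real.exp (u y) * (a y * b y)) x =
      2 * Real.exp (u x) * (pd k a x * pd k b x) := by
  rw [pdd_exp_mul hu (ha.mul hb) (by simp [ha0]), pd_mul ha.dAt hb.dAt, pdd_mul ha hb, ha0, hb0]
  ring

/-- Where `a` and `b` vanish the matrix is diagonal, so its inverse is explicit and most product
terms drop out of the first two derivatives. -/
theorem tensionNorm_horo_of_eq_zero {u₀ u₁ u₂ a b : E3 → ℝ} {x : E3} (h₀ : ContDiffAt ℝ 2 u₀ x)
    (h₁ : ContDiffAt ℝ 2 u₁ x) (h₂ : ContDiffAt ℝ 2 u₂ x) (ha : ContDiffAt ℝ 2 a x)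
    (hb : ContDiffAt ℝ 2 b x) (ha0 : a x = 0) (hb0 : b x = 0) :
    tensionNorm (fun y => horo (u₀ y) (u₁ y) (u₂ y) (a y) (b y)) x ^ 2 =
      horoTensionSq u₀ u₁ u₂ a b x := by
  have e₀ := h₀.exp
  have e₁ := h₁.exp
  have e₂ := h₂.exp
  set Ψ : E3 → Matrix (Fin 3) (Fin 3) ℝ := fun y => horo (u₀ y) (u₁ y) (u₂ y) (a y) (b y) with hΨ
  have p₀ := Real.exp_pos (u₀ x)
  have p₁ := Real.exp_pos (u₁ x)
  have p₂ := Real.exp_pos (u₂ x)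
  have hP : ∀ k, pderiv k Ψ x =
      !![Real.exp (u₀ x) * pd k u₀ x, Real.exp (u₀ x) * pd k a x, Real.exp (u₀ x) * pd k b x;
        Real.exp (u₀ x) * pd k a x, Real.exp (u₁ x) * pd k u₁ x, 0;
        Real.exp (u₀ x) * pd k b x, 0, Real.exp (u₂ x) * pd k u₂ x] := by
    intro k
    ext i j
    rw [pderiv_apply]
    have d : ∀ {u v : E3 → ℝ}, ContDiffAt ℝ 2 u x → ContDiffAt ℝ 2 v x → v x = 0 →
        pd k (fun y => Real.exp (u y) + Real.exp (u₀ y) * (v y * v y)) x =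
          Real.exp (u x) * pd k u x := fun {u v} hu hv hv0 => by
      rw [pd_add hu.exp.dAt (h₀.exp.mul (hv.mul hv)).dAt, pd_exp hu,
        pd_exp_mul_mul h₀ hv hv hv0 hv0, add_zero]
    fin_cases i <;> fin_cases j
    · exact pd_exp h₀
    · exact pd_exp_mul h₀ ha ha0
    · exact pd_exp_mul h₀ hb hb0
    · exact pd_exp_mul h₀ ha ha0
    · exact d h₁ ha ha0
    · exact pd_exp_mul_mul h₀ ha hb ha0 hb0
    · exact pd_exp_mul h₀ hb hb0
    · exact pd_exp_mul_mul h₀ ha hb ha0 hb0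
    · exact d h₂ hb hb0
  have hPP : ∀ k, pderiv k (pderiv k Ψ) x =
      !![Real.exp (u₀ x) * (pdd k u₀ x + pd k u₀ x ^ 2),
          Real.exp (u₀ x) * (pdd k a x + 2 * (pd k u₀ x * pd k a x)),
          Real.exp (u₀ x) * (pdd k b x + 2 * (pd k u₀ x * pd k b x));
        Real.exp (u₀ x) * (pdd k a x + 2 * (pd k u₀ x * pd k a x)),
          Real.exp (u₁ x) * (pdd k u₁ x + pd k u₁ x ^ 2) + 2 * Real.exp (u₀ x) * pd k a x ^ 2,
          2 * Real.exp (u₀ x) * (pd k a x * pd k b x);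
        Real.exp (u₀ x) * (pdd k b x + 2 * (pd k u₀ x * pd k b x)),
          2 * Real.exp (u₀ x) * (pd k a x * pd k b x),
          Real.exp (u₂ x) * (pdd k u₂ x + pd k u₂ x ^ 2) + 2 * Real.exp (u₀ x) * pd k b x ^ 2] := by
    intro k
    ext i j
    rw [pderiv_pderiv_apply]
    have d : ∀ {u v : E3 → ℝ}, ContDiffAt ℝ 2 u x → ContDiffAt ℝ 2 v x → v x = 0 →
        pdd k (fun y => Real.exp (u y) + Real.exp (u₀ y) * (v y * v y)) x =
          Real.exp (u x) * (pdd k u x + pd k u x ^ 2) + 2 * Real.exp (u₀ x) * pd k v x ^ 2 :=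
      fun {u v} hu hv hv0 => by
        rw [pdd_add hu.exp (h₀.exp.mul (hv.mul hv)), pdd_exp hu,
          pdd_exp_mul_mul h₀ hv hv hv0 hv0, pow_two (pd k v x)]
    fin_cases i <;> fin_cases j
    · exact pdd_exp h₀
    · exact pdd_exp_mul h₀ ha ha0
    · exact pdd_exp_mul h₀ hb hb0
    · exact pdd_exp_mul h₀ ha ha0
    · exact d h₁ ha ha0
    · exact pdd_exp_mul_mul h₀ ha hb ha0 hb0
    · exact pdd_exp_mul h₀ hb hb0
    · exact pdd_exp_mul_mul h₀ ha hb ha0 hb0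
    · exact d h₂ hb hb0
  have hI : (Ψ x)⁻¹ = !![(Real.exp (u₀ x))⁻¹, 0, 0; 0, (Real.exp (u₁ x))⁻¹, 0;
      0, 0, (Real.exp (u₂ x))⁻¹] := by
    apply Matrix.inv_eq_right_inv
    ext i j
    fin_cases i <;> fin_cases j <;> simp [hΨ, horo, ha0, hb0]
  have hT : tension Ψ x =
      !![Real.exp (u₀ x) * (lap u₀ x - Real.exp (u₀ x - u₁ x) * gradInner a a x -
          Real.exp (u₀ x - u₂ x) * gradInner b b x),
          Real.exp (u₀ x) * (lap a x + gradInner a u₀ x - gradInner a u₁ x),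
          Real.exp (u₀ x) * (lap b x + gradInner b u₀ x - gradInner b u₂ x);
        Real.exp (u₀ x) * (lap a x + gradInner a u₀ x - gradInner a u₁ x),
          Real.exp (u₁ x) * (lap u₁ x + Real.exp (u₀ x - u₁ x) * gradInner a a x),
          Real.exp (u₀ x) * gradInner a b x;
        Real.exp (u₀ x) * (lap b x + gradInner b u₀ x - gradInner b u₂ x),
          Real.exp (u₀ x) * gradInner a b x,
          Real.exp (u₂ x) * (lap u₂ x + Real.exp (u₀ x - u₂ x) * gradInner b b x)] := by
    simp only [tension, christoffel, hPP, hP, hI, lap, gradInner, Real.exp_sub]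
    ext i j
    fin_cases i <;> fin_cases j <;>
      simp [Fin.sum_univ_three] <;> field_simp <;> ring
  have key : metric (Ψ x) (tension Ψ x) (tension Ψ x) = horoTensionSq u₀ u₁ u₂ a b x := by
    rw [metric, hT, hI]
    simp only [horoTensionSq, Matrix.trace_fin_three, Matrix.mul_apply, Fin.sum_univ_three,
      Real.exp_sub]
    simp
    field_simp
    ring
  rw [tensionNorm, key, Real.sq_sqrt]
  unfold horoTensionSq
  positivity

/-- Congruences act by isometries, and a constant unipotent one translates `(a, b)`. This normalizes
`a x = b x = 0` without changing derivatives. The freedom in `G` lets each application choose its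
own frame. -/
theorem tensionNorm_sq_eq {Φ : E3 → Matrix (Fin 3) (Fin 3) ℝ} {u₀ u₁ u₂ a b : E3 → ℝ} {x : E3}
    (G : Matrix (Fin 3) (Fin 3) ℝ) (hG : G.det ≠ 0)
    (h : ∀ᶠ y in 𝓝 x, Φ y = Gᵀ * horo (u₀ y) (u₁ y) (u₂ y) (a y) (b y) * G)
    (h₀ : ContDiffAt ℝ 2 u₀ x) (h₁ : ContDiffAt ℝ 2 u₁ x) (h₂ : ContDiffAt ℝ 2 u₂ x)
    (ha : ContDiffAt ℝ 2 a x) (hb : ContDiffAt ℝ 2 b x) :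
    tensionNorm Φ x ^ 2 = horoTensionSq u₀ u₁ u₂ a b x := by
  set N : Matrix (Fin 3) (Fin 3) ℝ := !![1, a x, b x; 0, 1, 0; 0, 0, 1] with hN
  have ha' : ContDiffAt ℝ 2 (fun y => a y + -a x) x := ha.add contDiffAt_const
  have hb' : ContDiffAt ℝ 2 (fun y => b y + -b x) x := hb.add contDiffAt_const
  have hNG : (N * G).det ≠ 0 := by
    rw [Matrix.det_mul, hN, Matrix.det_fin_three]
    simpa using hG
  have e : Φ =ᶠ[𝓝 x] fun y => (N * G)ᵀ *
      horo (u₀ y) (u₁ y) (u₂ y) (a y + -a x) (b y + -b x) * (N * G) := by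
    filter_upwards [h] with y hy
    rw [hy, Matrix.transpose_mul]
    have : horo (u₀ y) (u₁ y) (u₂ y) (a y) (b y) =
        Nᵀ * horo (u₀ y) (u₁ y) (u₂ y) (a y + -a x) (b y + -b x) * N := by
      ext i j
      fin_cases i <;> fin_cases j <;>
        simp [hN, horo, Matrix.mul_apply, Fin.sum_univ_three] <;> ring
    rw [this]
    simp only [Matrix.mul_assoc]
  rw [tensionNorm_congr e, tensionNorm_conj _ hNG.isUnit (c2At_horo h₀ h₁ h₂ ha' hb'),
    tensionNorm_horo_of_eq_zero h₀ h₁ h₂ ha' hb' (by ring) (by ring)]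
  have q : ∀ {v : E3 → ℝ} (c : ℝ), ContDiffAt ℝ 2 v x →
      (∀ k, pd k (fun y => v y + c) x = pd k v x) ∧
        ∀ k, pdd k (fun y => v y + c) x = pdd k v x := fun {v} c hv =>
    ⟨fun k => by rw [pd_add hv.dAt (differentiableAt_const c), pd_const, add_zero],
      fun k => by rw [pdd_add hv contDiffAt_const, pdd_const, add_zero]⟩
  simp only [horoTensionSq, lap, gradInner, (q _ ha).1, (q _ ha).2, (q _ hb).1, (q _ hb).2]

/-! ### Derivatives of coordinates and of the distance to a point. -/

theorem pd_coord (k j : Fin 3) (x : E3) : pd k (fun y : E3 => y j) x = if j = k then 1 else 0 := by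
  have h : HasFDerivAt (fun y : E3 => y j) (EuclideanSpace.proj j : E3 →L[ℝ] ℝ) x :=
    (EuclideanSpace.proj j : E3 →L[ℝ] ℝ).hasFDerivAt
  rw [pd, h.fderiv]
  simp

theorem pdd_coord (k j : Fin 3) (x : E3) : pdd k (fun y : E3 => y j) x = 0 := by
  have : pd k (fun y : E3 => y j) = fun _ => if j = k then 1 else 0 := funext fun y => pd_coord k j y
  rw [pdd, this, pd_const]

theorem contDiff_coord {n : WithTop ℕ∞} (j : Fin 3) : ContDiff ℝ n fun y : E3 => y j :=
  (EuclideanSpace.proj j : E3 →L[ℝ] ℝ).contDiff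

theorem norm_sq_eq (x : E3) : ‖x‖ ^ 2 = x 0 ^ 2 + x 1 ^ 2 + x 2 ^ 2 := by
  simp [EuclideanSpace.norm_sq_eq, Fin.sum_univ_three]

theorem contDiffAt_dist {n : WithTop ℕ∞} {c x : E3} (h : x ≠ c) :
    ContDiffAt ℝ n (fun y => ‖y - c‖) x :=
  (contDiffAt_id.sub contDiffAt_const).norm ℝ (sub_ne_zero.2 h)

theorem dist_mul_self (c y : E3) : ‖y - c‖ * ‖y - c‖ =
    (y 0 - c 0) * (y 0 - c 0) + (y 1 - c 1) * (y 1 - c 1) + (y 2 - c 2) * (y 2 - c 2) := by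
  rw [← pow_two, norm_sq_eq]; simp; ring

theorem pd_sub_const (k j : Fin 3) (c : ℝ) (x : E3) :
    pd k (fun y : E3 => y j - c) x = if j = k then 1 else 0 := by
  simp only [sub_eq_add_neg]
  rw [pd_add (contDiff_coord (n := 2) j).contDiffAt.dAt (differentiableAt_const _), pd_coord,
    pd_const, add_zero]

theorem pdd_sub_const (k j : Fin 3) (c : ℝ) (x : E3) :
    pdd k (fun y : E3 => y j - c) x = 0 := by
  simp only [sub_eq_add_neg]
  rw [pdd_add (contDiff_coord j).contDiffAt contDiffAt_const, pdd_coord, pdd_const, add_zero]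

theorem contDiff_sub_const {n : WithTop ℕ∞} (j : Fin 3) (c : ℝ) :
    ContDiff ℝ n fun y : E3 => y j - c := (contDiff_coord j).sub contDiff_const

theorem pd_dist {c x : E3} (h : x ≠ c) (k : Fin 3) :
    pd k (fun y => ‖y - c‖) x = (x k - c k) / ‖x - c‖ := by
  have hd : ContDiffAt ℝ 2 (fun y : E3 => ‖y - c‖) x := contDiffAt_dist h
  -- The squared distance is a polynomial; differentiating it as a product determines the derivative
  -- of the distance.
  have h1 := pd_mul (k := k) hd.dAt hd.dAt
  have hc : ∀ j, ContDiffAt ℝ 2 (fun y : E3 => y j - c j) x := fun j =>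
    (contDiff_sub_const j _).contDiffAt
  simp only [dist_mul_self] at h1
  rw [pd_add (((hc 0).mul (hc 0)).add ((hc 1).mul (hc 1))).dAt ((hc 2).mul (hc 2)).dAt,
    pd_add ((hc 0).mul (hc 0)).dAt ((hc 1).mul (hc 1)).dAt] at h1
  simp only [pd_mul (hc _).dAt (hc _).dAt, pd_sub_const] at h1
  have hr : ‖x - c‖ ≠ 0 := norm_ne_zero_iff.2 (sub_ne_zero.2 h)
  rw [eq_div_iff hr]
  fin_cases k <;> simp at h1 ⊢ <;> linarith

theorem pdd_dist {c x : E3} (h : x ≠ c) (k : Fin 3) :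
    pdd k (fun y => ‖y - c‖) x = (1 - ((x k - c k) / ‖x - c‖) ^ 2) / ‖x - c‖ := by
  have hd : ContDiffAt ℝ 2 (fun y : E3 => ‖y - c‖) x := contDiffAt_dist h
  have h1 := pdd_mul (k := k) hd hd
  have hc : ∀ j, ContDiffAt ℝ 2 (fun y : E3 => y j - c j) x := fun j =>
    (contDiff_sub_const j _).contDiffAt
  simp only [dist_mul_self] at h1
  rw [pdd_add (((hc 0).mul (hc 0)).add ((hc 1).mul (hc 1))) ((hc 2).mul (hc 2)),
    pdd_add ((hc 0).mul (hc 0)) ((hc 1).mul (hc 1))] at h1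
  simp only [pdd_mul (hc _) (hc _), pd_sub_const, pdd_sub_const, pd_dist h] at h1
  have hr : ‖x - c‖ ≠ 0 := norm_ne_zero_iff.2 (sub_ne_zero.2 h)
  rw [eq_div_iff hr]
  fin_cases k <;> simp at h1 ⊢ <;> linarith

/-! ### Harmonic building blocks -/

@[simp] theorem axisPt_zero (t : ℝ) : axisPt t 0 = 0 := by simp [axisPt]
@[simp] theorem axisPt_one (t : ℝ) : axisPt t 1 = 0 := by simp [axisPt]
@[simp] theorem axisPt_two (t : ℝ) : axisPt t 2 = t := by simp [axisPt]

/-- Half the distance to `axisPt t` minus half the (signed) height over it. For `s = 1` this vanishes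
exactly on the part of the axis above `t`, for `s = -1` on the part below. -/
def cone (s t : ℝ) (x : E3) : ℝ := (‖x - axisPt t‖ - s * (x 2 - t)) / 2

/-- The squared distance to the axis. -/
def rsq (x : E3) : ℝ := x 0 ^ 2 + x 1 ^ 2

theorem rsq_nonneg (x : E3) : 0 ≤ rsq x := by unfold rsq; positivity

theorem continuous_cone (s t : ℝ) : Continuous (cone s t) := by
  unfold cone
  fun_prop

theorem contDiff_rsq {n : WithTop ℕ∞} : ContDiff ℝ n rsq :=
  ((contDiff_coord 0).pow 2).add ((contDiff_coord 1).pow 2)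

theorem dist_sq (t : ℝ) (x : E3) : ‖x - axisPt t‖ ^ 2 = rsq x + (x 2 - t) ^ 2 := by
  rw [pow_two, dist_mul_self, rsq]; simp; ring

theorem abs_height_le (t : ℝ) (x : E3) : |x 2 - t| ≤ ‖x - axisPt t‖ := by
  apply abs_le_of_sq_le_sq _ (norm_nonneg _)
  rw [dist_sq]
  linarith [rsq_nonneg x]

/-- Difference of squares: `(r - h)(r + h) = ρ²`. Near the axis ray where one factor vanishes, away
from the vertex, the other is smooth and positive, so the vanishing one is `ρ²` times a smooth
positive function. -/
theorem cone_mul {s : ℝ} (hs : s ^ 2 = 1) (t : ℝ) (x : E3) :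
    cone s t x * cone (-s) t x = rsq x / 4 := by
  have := dist_sq t x
  unfold cone
  linear_combination (1 / 4) * this - (1 / 4) * (x 2 - t) ^ 2 * hs

theorem cone_nonneg {s : ℝ} (hs : s ^ 2 = 1) (t : ℝ) (x : E3) : 0 ≤ cone s t x := by
  have h := abs_height_le t x
  have : s * (x 2 - t) ≤ |x 2 - t| := by
    rcases mul_self_eq_one_iff.1 ((pow_two s).symm.trans hs) with rfl | rfl
    · simpa using le_abs_self (x 2 - t)
    · rw [neg_one_mul]; exact neg_le_abs _
  unfold cone; linarith

theorem eq_axisPt_iff (x : E3) (t : ℝ) : x = axisPt t ↔ rsq x = 0 ∧ x 2 = t := by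
  constructor
  · rintro rfl; simp [rsq]
  · rintro ⟨h, h2⟩
    have : ‖x - axisPt t‖ ^ 2 = 0 := by rw [dist_sq, h, h2]; ring
    simpa [sub_eq_zero] using this

theorem cone_pos_of_rsq {s : ℝ} (hs : s ^ 2 = 1) (t : ℝ) {x : E3} (h : rsq x ≠ 0) :
    0 < cone s t x := by
  refine (cone_nonneg hs t x).lt_of_ne fun h0 => h ?_
  have := cone_mul hs t x
  rw [← h0] at this
  linarith

theorem cone_pos_of_height {s t : ℝ} {x : E3} (h : s * (x 2 - t) < 0) : 0 < cone s t x := by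
  have := norm_nonneg (x - axisPt t)
  unfold cone; linarith

theorem cone_axis {s t t' : ℝ} (hs : s ^ 2 = 1) (h : 0 ≤ s * (t' - t)) :
    cone s t (axisPt t') = 0 := by
  have h1 := dist_sq t (axisPt t')
  have h2 : ‖axisPt t' - axisPt t‖ = s * (t' - t) := by
    rw [← abs_of_nonneg h, ← abs_of_nonneg (norm_nonneg (axisPt t' - axisPt t)), ← sq_eq_sq_iff_abs_eq_abs,
      h1, mul_pow, hs]
    simp [rsq]
  simp [cone, h2]

theorem contDiffAt_cone {n : WithTop ℕ∞} {s t : ℝ} {x : E3} (h : x ≠ axisPt t) :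
    ContDiffAt ℝ n (cone s t) x :=
  ((contDiffAt_dist h).sub (contDiffAt_const.mul
    (contDiff_sub_const 2 t).contDiffAt)).div_const 2

theorem cone_eq (s t : ℝ) : cone s t =
    fun x => (1 / 2) * ‖x - axisPt t‖ + (-s / 2) * (x 2 - t) := by
  funext x; unfold cone; ring

theorem pd_cone {s t : ℝ} {x : E3} (h : x ≠ axisPt t) (k : Fin 3) :
    pd k (cone s t) x =
      (1 / 2) * ((x k - axisPt t k) / ‖x - axisPt t‖) + (-s / 2) * if 2 = k then 1 else 0 := by
  have hd : ContDiffAt ℝ 2 (fun y : E3 => ‖y - axisPt t‖) x := contDiffAt_dist h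
  have hc : ContDiffAt ℝ 2 (fun y : E3 => y 2 - t) x := (contDiff_sub_const 2 _).contDiffAt
  rw [cone_eq, pd_add (hd.dAt.const_mul _) (hc.dAt.const_mul _), pd_const_mul _ hd.dAt,
    pd_const_mul _ hc.dAt, pd_dist h, pd_sub_const]

theorem pdd_cone {s t : ℝ} {x : E3} (h : x ≠ axisPt t) (k : Fin 3) :
    pdd k (cone s t) x =
      (1 / 2) * ((1 - ((x k - axisPt t k) / ‖x - axisPt t‖) ^ 2) / ‖x - axisPt t‖) := by
  have hd : ContDiffAt ℝ 2 (fun y : E3 => ‖y - axisPt t‖) x := contDiffAt_dist h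
  have hc : ContDiffAt ℝ 2 (fun y : E3 => y 2 - t) x := (contDiff_sub_const 2 _).contDiffAt
  rw [cone_eq, pdd_add (contDiffAt_const.mul hd) (contDiffAt_const.mul hc), pdd_const_mul _ hd,
    pdd_const_mul _ hc, pdd_dist h, pdd_sub_const]
  ring

/-- Up to constants, the logarithm is the Newtonian potential of a uniformly charged half-line,
namely the ray on which the cone function vanishes. -/
theorem lap_log_cone {s t : ℝ} (hs : s ^ 2 = 1) {x : E3} (h : x ≠ axisPt t)
    (hg : cone s t x ≠ 0) : lap (fun y => Real.log (cone s t y)) x = 0 := by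
  have hr : ‖x - axisPt t‖ ≠ 0 := norm_ne_zero_iff.2 (sub_ne_zero.2 h)
  have h2 := dist_sq t x
  have key : ∑ k, pdd k (cone s t) x * cone s t x - ∑ k, pd k (cone s t) x ^ 2 = 0 := by
    simp only [Fin.sum_univ_three, pd_cone h, pdd_cone h, axisPt_zero, axisPt_one, axisPt_two]
    unfold cone rsq at *
    generalize ‖x - axisPt t‖ = r at *
    simp
    field_simp
    linear_combination (2 * r - s * (x 2 - t)) * h2 - r ^ 3 * hs
  have e : ∀ k, pdd k (fun y => Real.log (cone s t y)) x =
      (pdd k (cone s t) x * cone s t x - pd k (cone s t) x ^ 2) / cone s t x ^ 2 := fun k => by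
    rw [pdd_log (contDiffAt_cone h) hg]
    field_simp
  simp only [lap, e, ← Finset.sum_div, Finset.sum_sub_distrib, key, zero_div]

theorem lap_congr_at {u v : E3 → ℝ} {x : E3} (h : u =ᶠ[𝓝 x] v) : lap u x = lap v x :=
  Finset.sum_congr rfl fun _ _ => pdd_congr_at h

theorem lap_const (c : ℝ) (x : E3) : lap (fun _ => c) x = 0 := by
  simp [lap, pdd_const]

theorem lap_add {u v : E3 → ℝ} {x : E3} (hu : ContDiffAt ℝ 2 u x) (hv : ContDiffAt ℝ 2 v x) :
    lap (fun y => u y + v y) x = lap u x + lap v x := by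
  simp only [lap, pdd_add hu hv, Finset.sum_add_distrib]

theorem lap_neg {u : E3 → ℝ} {x : E3} (hu : ContDiffAt ℝ 2 u x) :
    lap (fun y => -u y) x = -lap u x := by
  have : (fun y => -u y) = fun y => (-1) * u y := funext fun y => by ring
  simp only [this, lap, pdd_const_mul _ hu, ← Finset.mul_sum]
  ring

theorem ne_axisPt_of_rsq {x : E3} (h : rsq x ≠ 0) (t : ℝ) : x ≠ axisPt t :=
  fun h0 => h ((eq_axisPt_iff x t).1 h0).1

theorem lap_log_rsq {x : E3} (h : rsq x ≠ 0) : lap (fun y => Real.log (rsq y)) x = 0 := by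
  have hc : ∀ s : ℝ, s ^ 2 = 1 → cone s 0 x ≠ 0 := fun s hs => (cone_pos_of_rsq hs 0 h).ne'
  have hn := ne_axisPt_of_rsq h 0
  have hl : ∀ s : ℝ, s ^ 2 = 1 → ContDiffAt ℝ 2 (fun y => Real.log (cone s 0 y)) x := fun s hs =>
    (contDiffAt_cone hn).log (hc s hs)
  -- The potential of the full line is the sum of those of two complementary half-lines.
  have e : (fun y => Real.log (rsq y)) =ᶠ[𝓝 x] fun y =>
      Real.log 4 + (Real.log (cone 1 0 y) + Real.log (cone (-1) 0 y)) := by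
    filter_upwards [(continuous_cone 1 0).continuousAt.eventually_ne (hc 1 (by norm_num)),
      (continuous_cone (-1) 0).continuousAt.eventually_ne (hc (-1) (by norm_num))] with y h1 h2
    rw [← Real.log_mul h1 h2, ← Real.log_mul (by norm_num) (mul_ne_zero h1 h2),
      cone_mul (by norm_num)]
    congr 1; ring
  have l1 := hl 1 (by norm_num)
  have l2 := hl (-1) (by norm_num)
  rw [lap_congr_at e, lap_add contDiffAt_const (l1.add l2), lap_add l1 l2, lap_const,
    lap_log_cone (by norm_num) hn (hc 1 (by norm_num)),
    lap_log_cone (by norm_num) hn (hc (-1) (by norm_num))]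
  ring

/-! ### Local models near the axis -/

/-- A vector perpendicular to `v`. -/
def perp (v : Fin 2 → ℝ) : Fin 2 → ℝ := ![-v 1, v 0]

/-- In a constant frame the map is diagonal, hence lies in a flat whose affine coordinates are the
logarithms of the entries; harmonic logarithms make it a harmonic map. -/
theorem tensionNorm_param_eq_zero {F : E3 → Matrix (Fin 2) (Fin 2) ℝ} {ω : E3 → Fin 2 → ℝ}
    {g h : E3 → ℝ} {ξ η c : Fin 2 → ℝ} {x : E3} (hd : ξ 0 * η 1 - ξ 1 * η 0 ≠ 0)
    (hF : ∀ᶠ y in 𝓝 x, ∀ i j, F y i j = g y * (ξ i * ξ j) + h y * (η i * η j))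
    (hω : ∀ᶠ y in 𝓝 x, ω y = c) (hg : ContDiffAt ℝ 2 g x) (hh : ContDiffAt ℝ 2 h x)
    (hg0 : 0 < g x) (hh0 : 0 < h x) (lg : lap (fun y => Real.log (g y)) x = 0)
    (lh : lap (fun y => Real.log (h y)) x = 0) :
    tensionNorm (fun y => param (F y) (ω y)) x = 0 := by
  set d := ξ 0 * η 1 - ξ 1 * η 0 with hd'
  have Lg : ContDiffAt ℝ 2 (fun y => Real.log (g y)) x := hg.log hg0.ne'
  have Lh : ContDiffAt ℝ 2 (fun y => Real.log (h y)) x := hh.log hh0.ne'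
  have key := tensionNorm_sq_eq (Φ := fun y => param (F y) (ω y)) (x := x)
    (u₀ := fun y => -(Real.log (g y) + Real.log (h y))) (u₁ := fun y => Real.log (g y))
    (u₂ := fun y => Real.log (h y)) (a := fun _ => 0) (b := fun _ => 0)
    -- The factor `d⁻¹` compensates `det F = g h d²`.
    !![d⁻¹, -(d⁻¹ * c 0), -(d⁻¹ * c 1); 0, ξ 0, ξ 1; 0, η 0, η 1]
    (by
      have : (!![d⁻¹, -(d⁻¹ * c 0), -(d⁻¹ * c 1); 0, ξ 0, ξ 1; 0, η 0, η 1]).det = d⁻¹ * d := by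
        rw [Matrix.det_fin_three]; simp [hd']; ring
      rw [this, inv_mul_cancel₀ hd]
      exact one_ne_zero) ?_
    (Lg.add Lh).neg Lg Lh contDiffAt_const contDiffAt_const
  · have z : ∀ (u : E3 → ℝ), gradInner (fun _ => 0) u x = 0 := fun u => by
      simp [gradInner, pd_const]
    rw [horoTensionSq, lap_neg (Lg.add Lh), lap_add Lg Lh, lg, lh, lap_const] at key
    simp only [z] at key
    have : tensionNorm (fun y => param (F y) (ω y)) x ^ 2 = 0 := by rw [key]; ring
    exact pow_eq_zero_iff (two_ne_zero) |>.1 this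
  · filter_upwards [hF, hω, hg.continuousAt.eventually (lt_mem_nhds hg0),
      hh.continuousAt.eventually (lt_mem_nhds hh0)] with y h1 h2 h3 h4
    have hdet : (F y).det = g y * h y * d ^ 2 := by
      rw [Matrix.det_fin_two, h1, h1, h1, h1, hd']
      ring
    have hex : Real.exp (-(Real.log (g y) + Real.log (h y))) = (g y * h y)⁻¹ := by
      rw [Real.exp_neg, Real.exp_add, Real.exp_log h3, Real.exp_log h4]
    rw [param, hdet, h2, horo, hex, Real.exp_log h3, Real.exp_log h4]
    have h3' := h3.ne'
    have h4' := h4.ne'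
    ext i j
    fin_cases i <;> fin_cases j <;>
      simp [h1, Matrix.mul_apply, Fin.sum_univ_three] <;>
      field_simp <;> ring

/-! ### Bounded tension at interior points of axis rods. -/

/-- Near `x`, the symmetric matrix `F` degenerates on the axis, with kernel spanned by `v`. -/
structure AdaptedAt (v : Fin 2 → ℝ) (F : E3 → Matrix (Fin 2) (Fin 2) ℝ) (x : E3)
    (p q s : E3 → ℝ) : Prop where
  smooth_p : ContDiffAt ℝ 2 p x
  smooth_q : ContDiffAt ℝ 2 q x
  smooth_s : ContDiffAt ℝ 2 s x
  eq : ∀ᶠ y in 𝓝 x, ∀ i j, F y i j = rsq y * p y * (v i * v j) +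
    rsq y * q y * (v i * perp v j + perp v i * v j) + s y * (perp v i * perp v j)

theorem continuousAt_lap {u : E3 → ℝ} {x : E3} (h : ContDiffAt ℝ 2 u x) :
    ContinuousAt (lap u) x := by
  unfold lap
  refine tendsto_finsetSum _ fun k _ => ?_
  exact ((h.partial_deriv (m := 1) (by norm_num)).partial_deriv (m := 0) (by norm_num)).continuousAt

theorem continuousAt_gradInner {u v : E3 → ℝ} {x : E3} (h : ContDiffAt ℝ 2 u x)
    (h' : ContDiffAt ℝ 2 v x) : ContinuousAt (gradInner u v) x := by
  unfold gradInner
  refine tendsto_finsetSum _ fun k _ => ?_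
  exact (h.partial_deriv (m := 1) (by norm_num)).continuousAt.mul
    (h'.partial_deriv (m := 1) (by norm_num)).continuousAt

theorem gradInner_self_nonneg (u : E3 → ℝ) (x : E3) : 0 ≤ gradInner u u x :=
  Finset.sum_nonneg fun _ _ => mul_self_nonneg _

theorem pd_rsq (k : Fin 3) (x : E3) : pd k rsq x = if k = 2 then 0 else 2 * x k := by
  have hc : ∀ j, ContDiffAt ℝ 2 (fun y : E3 => y j) x := fun j => (contDiff_coord j).contDiffAt
  have : rsq = fun y : E3 => y 0 * y 0 + y 1 * y 1 := funext fun y => by simp [rsq, pow_two]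
  rw [this, pd_add ((hc 0).mul (hc 0)).dAt ((hc 1).mul (hc 1)).dAt, pd_mul (hc 0).dAt (hc 0).dAt,
    pd_mul (hc 1).dAt (hc 1).dAt, pd_coord, pd_coord]
  fin_cases k <;> simp <;> ring

/-- Cauchy–Schwarz together with `|∇ log ρ²|² = 4/ρ²`: the weight `ρ²` exactly absorbs the
singularity of the gradient. -/
theorem gradInner_log_rsq_sq_le (a : E3 → ℝ) {x : E3} (h : rsq x ≠ 0) :
    rsq x * gradInner a (fun y => Real.log (rsq y)) x ^ 2 ≤ 4 * gradInner a a x := by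
  simp only [gradInner, pd_log contDiff_rsq.contDiffAt h, pd_rsq, Fin.sum_univ_three]
  simp
  generalize pd 0 a x = a0
  generalize pd 1 a x = a1
  generalize pd 2 a x = a2
  have hpos : 0 < rsq x := (rsq_nonneg x).lt_of_ne' h
  have e : rsq x * (a0 * (2 * x 0 / rsq x) + a1 * (2 * x 1 / rsq x)) ^ 2 =
      4 * ((a0 * x 0 + a1 * x 1) ^ 2 / rsq x) := by
    field_simp; ring
  rw [e]
  have : (a0 * x 0 + a1 * x 1) ^ 2 / rsq x ≤ a0 * a0 + a1 * a1 + a2 * a2 := by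
    rw [div_le_iff₀ hpos, rsq]
    nlinarith [sq_nonneg (a0 * x 1 - a1 * x 0), mul_nonneg (sq_nonneg a2) (rsq_nonneg x),
      show rsq x = x 0 ^ 2 + x 1 ^ 2 from rfl]
  linarith

/-- The bound for the tension near an interior point of an axis rod. -/
def axisBound (p c a : E3 → ℝ) (y : E3) : ℝ :=
  (lap (fun y => Real.log (p y)) y - rsq y * (p y / c y) * gradInner a a y) ^ 2 +
    (lap (fun y => Real.log (c y)) y + rsq y * (p y / c y) * gradInner a a y) ^ 2 +
    (lap (fun y => Real.log (p y)) y + lap (fun y => Real.log (c y)) y) ^ 2 +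
    4 * (p y / c y) * (rsq y * (lap a y + gradInner a (fun y => Real.log (p y)) y -
      gradInner a (fun y => Real.log (c y)) y) ^ 2 + 4 * gradInner a a y)

theorem gradInner_add_right {a u v : E3 → ℝ} {x : E3} (hu : ContDiffAt ℝ 2 u x)
    (hv : ContDiffAt ℝ 2 v x) :
    gradInner a (fun y => u y + v y) x = gradInner a u x + gradInner a v x := by
  simp only [gradInner, pd_add hu.dAt hv.dAt, mul_add, Finset.sum_add_distrib]

/-- Completing the square along `v` gives horospherical coordinates with `exp u₀ = ρ² p`, `exp u₁ =
s - ρ² q²/p` and `a = q/p`. As `log ρ²` is harmonic, it survives only in the gradient term of the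
equation for `a`, which is weighted by `exp (u₀ - u₁)`, of order `ρ²`. -/
theorem tensionNorm_sq_le_axisBound {v : Fin 2 → ℝ} (hv : v ≠ 0)
    {F : E3 → Matrix (Fin 2) (Fin 2) ℝ} {ω : E3 → Fin 2 → ℝ} {c : Fin 2 → ℝ} {x : E3}
    {p q s : E3 → ℝ} (hF : AdaptedAt v F x p q s) (hω : ∀ᶠ y in 𝓝 x, ω y = c)
    (hx : rsq x ≠ 0) (hp : 0 < p x) (hs : 0 < s x - rsq x * (q x ^ 2 / p x)) :
    tensionNorm (fun y => param (F y) (ω y)) x ^ 2 ≤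
      axisBound p (fun y => s y - rsq y * (q y ^ 2 / p y)) (fun y => q y / p y) x := by
  set d := v 0 ^ 2 + v 1 ^ 2 with hd'
  have hd : d ≠ 0 := by
    intro h0
    apply hv
    have h1 : v 0 = 0 := by nlinarith [sq_nonneg (v 0), sq_nonneg (v 1)]
    have h2 : v 1 = 0 := by nlinarith [sq_nonneg (v 0), sq_nonneg (v 1)]
    ext i; fin_cases i <;> simp [h1, h2]
  set C : E3 → ℝ := fun y => s y - rsq y * (q y ^ 2 / p y) with hC
  set a : E3 → ℝ := fun y => q y / p y with ha
  have hr : 0 < rsq x := (rsq_nonneg x).lt_of_ne' hx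
  have sR : ContDiffAt ℝ 2 rsq x := contDiff_rsq.contDiffAt
  have sC : ContDiffAt ℝ 2 C x :=
    hF.smooth_s.sub (sR.mul ((hF.smooth_q.pow 2).div hF.smooth_p hp.ne'))
  have sa : ContDiffAt ℝ 2 a x := hF.smooth_q.div hF.smooth_p hp.ne'
  have LR : ContDiffAt ℝ 2 (fun y => Real.log (rsq y)) x := sR.log hx
  have Lp : ContDiffAt ℝ 2 (fun y => Real.log (p y)) x := hF.smooth_p.log hp.ne'
  have Lc : ContDiffAt ℝ 2 (fun y => Real.log (C y)) x := sC.log hs.ne'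
  have key := tensionNorm_sq_eq (Φ := fun y => param (F y) (ω y)) (x := x)
    (u₀ := fun y => Real.log (rsq y) + Real.log (p y)) (u₁ := fun y => Real.log (C y))
    (u₂ := fun y => -(Real.log (rsq y) + Real.log (p y) + Real.log (C y)))
    (a := a) (b := fun _ => 0)
    -- Ordering the frame as rod direction, its perpendicular, fibre of `ω` puts the cross term of
    -- `F` into `a` and leaves `b = 0`.
    !![0, v 0, v 1; 0, -v 1, v 0; d⁻¹, -(d⁻¹ * c 0), -(d⁻¹ * c 1)]
    (by
      have : (!![0, v 0, v 1; 0, -v 1, v 0; d⁻¹, -(d⁻¹ * c 0), -(d⁻¹ * c 1)]).det = d⁻¹ * d := by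
        rw [Matrix.det_fin_three]; simp [hd']; ring
      rw [this, inv_mul_cancel₀ hd]
      exact one_ne_zero) ?_
    (LR.add Lp) Lc (LR.add Lp |>.add Lc).neg sa contDiffAt_const
  · rw [key, axisBound, horoTensionSq, lap_neg ((LR.add Lp).add Lc), lap_add (LR.add Lp) Lc,
      lap_add LR Lp, lap_log_rsq hx, lap_const, gradInner_add_right LR Lp]
    have z : ∀ (u : E3 → ℝ), gradInner (fun _ => 0) u x = 0 := fun u => by
      simp [gradInner, pd_const]
    have z' : gradInner a (fun _ => 0) x = 0 := by simp [gradInner, pd_const]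
    have hex : Real.exp (Real.log (rsq x) + Real.log (p x) - Real.log (C x)) =
        rsq x * (p x / C x) := by
      rw [Real.exp_sub, Real.exp_add, Real.exp_log hr, Real.exp_log hp, Real.exp_log hs]
      ring
    simp only [z, z', hex]
    have hg := gradInner_log_rsq_sq_le a hx
    have hpc : 0 < p x / C x := div_pos hp hs
    have h1 : 2 * (rsq x * (p x / C x)) * (lap a x + (gradInner a (fun y => Real.log (rsq y)) x +
        gradInner a (fun y => Real.log (p y)) x) - gradInner a (fun y => Real.log (C y)) x) ^ 2 ≤
        4 * (p x / C x) * (rsq x * (lap a x + gradInner a (fun y => Real.log (p y)) x -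
          gradInner a (fun y => Real.log (C y)) x) ^ 2 + 4 * gradInner a a x) := by
      generalize gradInner a (fun y => Real.log (rsq y)) x = Y at *
      set X := lap a x + gradInner a (fun y => Real.log (p y)) x -
          gradInner a (fun y => Real.log (C y)) x with hX
      have e : lap a x + (Y + gradInner a (fun y => Real.log (p y)) x) -
          gradInner a (fun y => Real.log (C y)) x = X + Y := by rw [hX]; ring
      rw [e]
      -- Separates the part `X` built from smooth functions from the part `Y`, which is singular on
      -- the axis.
      have h2 : (X + Y) ^ 2 ≤ 2 * (X ^ 2 + Y ^ 2) := by nlinarith [sq_nonneg (X - Y)]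
      calc 2 * (rsq x * (p x / C x)) * (X + Y) ^ 2
          ≤ 2 * (rsq x * (p x / C x)) * (2 * (X ^ 2 + Y ^ 2)) := by gcongr
        _ = 4 * (p x / C x) * (rsq x * X ^ 2 + rsq x * Y ^ 2) := by ring
        _ ≤ _ := by gcongr
    nlinarith [h1]
  · filter_upwards [hF.eq, hω, hF.smooth_p.continuousAt.eventually (lt_mem_nhds hp),
      sC.continuousAt.eventually (lt_mem_nhds hs), sR.continuousAt.eventually (lt_mem_nhds hr)]
      with y h1 h2 h3 h4 h5
    have hCs : s y = C y + rsq y * (q y ^ 2 / p y) := by rw [hC]; ring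
    have hdet : (F y).det = rsq y * p y * C y * d ^ 2 := by
      rw [Matrix.det_fin_two, h1, h1, h1, h1, hd', hCs]
      have := h3.ne'
      simp [perp]
      field_simp
      ring
    have hex : Real.exp (-(Real.log (rsq y) + Real.log (p y) + Real.log (C y))) =
        (rsq y * p y * C y)⁻¹ := by
      rw [Real.exp_neg, Real.exp_add, Real.exp_add, Real.exp_log h3, Real.exp_log h4,
        Real.exp_log h5]
    have hex' : Real.exp (Real.log (rsq y) + Real.log (p y)) = rsq y * p y := by
      rw [Real.exp_add, Real.exp_log h3, Real.exp_log h5]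
    rw [param, hdet, h2, horo, hex, hex', Real.exp_log h4, h1, h1, h1, hCs]
    have h3' := h3.ne'
    have h4' := h4.ne'
    have h5' := h5.ne'
    have hay : a y = q y / p y := rfl
    clear_value C d
    ext i j
    fin_cases i <;> fin_cases j <;>
      simp [Matrix.mul_apply, Fin.sum_univ_three, perp, hay] <;>
      field_simp <;> ring

/-- The bounding function no longer contains `log ρ²`, so it is continuous up to the axis. -/
theorem AdaptedAt.eventually_tensionNorm_le {v : Fin 2 → ℝ} (hv : v ≠ 0)
    {F : E3 → Matrix (Fin 2) (Fin 2) ℝ} {ω : E3 → Fin 2 → ℝ} {c : Fin 2 → ℝ} {x : E3}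
    {p q s : E3 → ℝ} (hF : AdaptedAt v F x p q s) (hω : ∀ᶠ y in 𝓝 x, ω y = c)
    (hx : rsq x = 0) (hp : 0 < p x) (hs : 0 < s x) :
    ∃ C : ℝ, ∀ᶠ y in 𝓝 x, rsq y ≠ 0 → tensionNorm (fun y => param (F y) (ω y)) y ≤ C := by
  set C : E3 → ℝ := fun y => s y - rsq y * (q y ^ 2 / p y) with hC
  set a : E3 → ℝ := fun y => q y / p y with ha
  have sR : ContDiffAt ℝ 2 rsq x := contDiff_rsq.contDiffAt
  have sC : ContDiffAt ℝ 2 C x :=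
    hF.smooth_s.sub (sR.mul ((hF.smooth_q.pow 2).div hF.smooth_p hp.ne'))
  have sa : ContDiffAt ℝ 2 a x := hF.smooth_q.div hF.smooth_p hp.ne'
  have hCx : 0 < C x := by simpa [hC, hx] using hs
  have Lp : ContDiffAt ℝ 2 (fun y => Real.log (p y)) x := hF.smooth_p.log hp.ne'
  have Lc : ContDiffAt ℝ 2 (fun y => Real.log (C y)) x := sC.log hCx.ne'
  have hB : ContinuousAt (axisBound p C a) x := by
    unfold axisBound
    have c1 := continuousAt_lap Lp
    have c2 := continuousAt_lap Lc
    have c3 := continuousAt_lap sa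
    have c4 := continuousAt_gradInner sa sa
    have c5 := continuousAt_gradInner sa Lp
    have c6 := continuousAt_gradInner sa Lc
    have c7 := hF.smooth_p.continuousAt.div sC.continuousAt hCx.ne'
    have c8 := sR.continuousAt
    exact ((((c1.sub ((c8.mul c7).mul c4)).pow 2).add ((c2.add ((c8.mul c7).mul c4)).pow 2)).add
      ((c1.add c2).pow 2)).add ((continuousAt_const.mul c7).mul
        ((c8.mul (((c3.add c5).sub c6).pow 2)).add (continuousAt_const.mul c4)))
  refine ⟨Real.sqrt (axisBound p C a x + 1), ?_⟩
  filter_upwards [hB.eventually (gt_mem_nhds (lt_add_one _)), hF.smooth_p.eventually_two,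
    hF.smooth_q.eventually_two, hF.smooth_s.eventually_two, hF.eq.eventually_nhds,
    hω.eventually_nhds, hF.smooth_p.continuousAt.eventually (lt_mem_nhds hp),
      sC.continuousAt.eventually (lt_mem_nhds hCx)] with y h1 h2 h3 h4 h5 h6 h7 h8 h9
  apply Real.le_sqrt_of_sq_le
  exact (tensionNorm_sq_le_axisBound hv ⟨h2, h3, h4, h5⟩ h6 h9 h7 h8).trans h1.le

/-! ### The asymptotic region -/

theorem two_le_infty : (2 : WithTop ℕ∞) ≤ ((⊤ : ℕ∞) : WithTop ℕ∞) := by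
  exact WithTop.coe_le_coe.2 (le_top : (2 : ℕ∞) ≤ ⊤)

theorem abs_eq_one_of_sq {s : ℝ} (hs : s ^ 2 = 1) : |s| = 1 := by
  rcases mul_self_eq_one_iff.1 ((pow_two s).symm.trans hs) with rfl | rfl <;> simp

theorem abs_gradInner_le {u v : E3 → ℝ} {x : E3} {P Q : ℝ} (hu : ∀ k, |pd k u x| ≤ P)
    (hv : ∀ k, |pd k v x| ≤ Q) : |gradInner u v x| ≤ 3 * (P * Q) := by
  have hP : 0 ≤ P := (abs_nonneg _).trans (hu 0)
  have : |gradInner u v x| ≤ ∑ _k : Fin 3, P * Q := by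
    refine (Finset.abs_sum_le_sum_abs _ _).trans (Finset.sum_le_sum fun k _ => ?_)
    rw [abs_mul]
    exact mul_le_mul (hu k) (hv k) (abs_nonneg _) hP
  simpa using this

theorem abs_lap_le {u : E3 → ℝ} {x : E3} {P : ℝ} (hu : ∀ k, |pdd k u x| ≤ P) :
    |lap u x| ≤ 3 * P := by
  have : |lap u x| ≤ ∑ _k : Fin 3, P :=
    (Finset.abs_sum_le_sum_abs _ _).trans (Finset.sum_le_sum fun k _ => hu k)
  simpa using this

/-- Power counting with `t = 1/r`. The equations for `a` and `b` give `t³ (t²)² = t⁷`; every other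
term is of order `t¹⁰`. -/
theorem horoTensionSq_le {u₀ u₁ u₂ a b : E3 → ℝ} {x : E3} {M t : ℝ} (ht : 0 ≤ t) (ht1 : t ≤ 1)
    (l₀ : lap u₀ x = 0) (l₁ : lap u₁ x = 0) (l₂ : lap u₂ x = 0)
    (g₀ : ∀ k, |pd k u₀ x| ≤ 8 * t) (g₁ : ∀ k, |pd k u₁ x| ≤ 4 * t)
    (g₂ : ∀ k, |pd k u₂ x| ≤ 4 * t) (ha : ∀ k, |pd k a x| ≤ M * t)
    (hb : ∀ k, |pd k b x| ≤ M * t) (ha' : ∀ k, |pdd k a x| ≤ M * t ^ 2)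
    (hb' : ∀ k, |pdd k b x| ≤ M * t ^ 2) (e₁ : Real.exp (u₀ x - u₁ x) ≤ 64 * t ^ 3)
    (e₂ : Real.exp (u₀ x - u₂ x) ≤ 64 * t ^ 3) :
    horoTensionSq u₀ u₁ u₂ a b x ≤
      (6 * (192 * M ^ 2) ^ 2 + 256 * (39 * M) ^ 2 + 2 * 64 ^ 2 * (3 * M ^ 2) ^ 2) * t ^ 7 := by
  have p₁ := (Real.exp_pos (u₀ x - u₁ x)).le
  have p₂ := (Real.exp_pos (u₀ x - u₂ x)).le
  have A := abs_gradInner_le ha ha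
  have B := abs_gradInner_le hb hb
  have AB := abs_gradInner_le ha hb
  rw [abs_of_nonneg (gradInner_self_nonneg _ _)] at A B
  have qA := gradInner_self_nonneg a x
  have qB := gradInner_self_nonneg b x
  -- Here `39 = 3 + 3 · 8 + 3 · 4`, one summand for each of the three terms.
  have X : |lap a x + gradInner a u₀ x - gradInner a u₁ x| ≤ 39 * M * t ^ 2 := by
    have h1 := abs_le.1 (abs_lap_le ha')
    have h2 := abs_le.1 (abs_gradInner_le ha g₀)
    have h3 := abs_le.1 (abs_gradInner_le ha g₁)
    rw [abs_le]; constructor <;> nlinarith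
  have Y : |lap b x + gradInner b u₀ x - gradInner b u₂ x| ≤ 39 * M * t ^ 2 := by
    have h1 := abs_le.1 (abs_lap_le hb')
    have h2 := abs_le.1 (abs_gradInner_le hb g₀)
    have h3 := abs_le.1 (abs_gradInner_le hb g₂)
    rw [abs_le]; constructor <;> nlinarith
  have hA : Real.exp (u₀ x - u₁ x) * gradInner a a x ≤ 192 * M ^ 2 * t ^ 5 :=
    (mul_le_mul e₁ A qA (by positivity)).trans_eq (by ring)
  have hB : Real.exp (u₀ x - u₂ x) * gradInner b b x ≤ 192 * M ^ 2 * t ^ 5 :=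
    (mul_le_mul e₂ B qB (by positivity)).trans_eq (by ring)
  have nA := mul_nonneg p₁ qA
  have nB := mul_nonneg p₂ qB
  have X2 := pow_le_pow_left₀ (abs_nonneg _) X 2
  have Y2 := pow_le_pow_left₀ (abs_nonneg _) Y 2
  have AB2 := pow_le_pow_left₀ (abs_nonneg _) AB 2
  rw [sq_abs] at X2 Y2 AB2
  rw [horoTensionSq, l₀, l₁, l₂]
  have t10 : t ^ 10 ≤ t ^ 7 := pow_le_pow_of_le_one ht ht1 (by norm_num)
  generalize Real.exp (u₀ x - u₁ x) * gradInner a a x = α at *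
  generalize Real.exp (u₀ x - u₂ x) * gradInner b b x = β at *
  have s1 : (0 - α - β) ^ 2 ≤ 4 * (192 * M ^ 2) ^ 2 * t ^ 10 := by
    calc (0 - α - β) ^ 2 = (α + β) ^ 2 := by ring
      _ ≤ (192 * M ^ 2 * t ^ 5 + 192 * M ^ 2 * t ^ 5) ^ 2 := by gcongr
      _ = _ := by ring
  have s2 : (0 + α) ^ 2 ≤ (192 * M ^ 2) ^ 2 * t ^ 10 := by
    calc (0 + α) ^ 2 = α ^ 2 := by ring
      _ ≤ (192 * M ^ 2 * t ^ 5) ^ 2 := by gcongr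
      _ = _ := by ring
  have s3 : (0 + β) ^ 2 ≤ (192 * M ^ 2) ^ 2 * t ^ 10 := by
    calc (0 + β) ^ 2 = β ^ 2 := by ring
      _ ≤ (192 * M ^ 2 * t ^ 5) ^ 2 := by gcongr
      _ = _ := by ring
  have s4 := mul_le_mul e₁ X2 (sq_nonneg _) (by positivity)
  have s5 := mul_le_mul e₂ Y2 (sq_nonneg _) (by positivity)
  have s6 := mul_le_mul (mul_le_mul e₁ e₂ p₂ (by positivity)) AB2 (sq_nonneg _) (by positivity)
  have s7 : (6 * (192 * M ^ 2) ^ 2 + 2 * 64 ^ 2 * (3 * M ^ 2) ^ 2) * t ^ 10 ≤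
      (6 * (192 * M ^ 2) ^ 2 + 2 * 64 ^ 2 * (3 * M ^ 2) ^ 2) * t ^ 7 := by gcongr
  linarith

/-! ### The polar angle and functions of it. -/

/-- The cosine of the polar angle. -/
def ang (x : E3) : ℝ := x 2 / ‖x‖

theorem abs_coord_le (k : Fin 3) (x : E3) : |x k| ≤ ‖x‖ := by
  simpa using PiLp.norm_apply_le x k

theorem abs_ang_le (x : E3) : |ang x| ≤ 1 := by
  rw [ang, abs_div, abs_norm]
  exact div_le_one_of_le₀ (abs_coord_le 2 x) (norm_nonneg _)

theorem contDiffAt_ang {n : WithTop ℕ∞} {x : E3} (h : x ≠ 0) : ContDiffAt ℝ n ang x :=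
  (contDiff_coord 2).contDiffAt.div (contDiffAt_id.norm ℝ h) (norm_ne_zero_iff.2 h)

theorem pd_norm {x : E3} (h : x ≠ 0) (k : Fin 3) : pd k (fun y => ‖y‖) x = x k / ‖x‖ := by
  simpa using pd_dist h k

theorem pdd_norm {x : E3} (h : x ≠ 0) (k : Fin 3) :
    pdd k (fun y => ‖y‖) x = (1 - (x k / ‖x‖) ^ 2) / ‖x‖ := by
  simpa using pdd_dist h k

theorem abs_pd_norm_le {x : E3} (h : x ≠ 0) (k : Fin 3) : |pd k (fun y => ‖y‖) x| ≤ 1 := by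
  rw [pd_norm h, abs_div, abs_norm]
  exact div_le_one_of_le₀ (abs_coord_le k x) (norm_nonneg _)

theorem abs_pdd_norm_le {x : E3} (h : x ≠ 0) (k : Fin 3) :
    |pdd k (fun y => ‖y‖) x| ≤ ‖x‖⁻¹ := by
  have h1 := abs_pd_norm_le h k
  rw [pd_norm h] at h1
  have hr := norm_pos_iff.2 h
  rw [pdd_norm h, abs_div, abs_norm, inv_eq_one_div]
  gcongr
  have h2 := (sq_le_one_iff_abs_le_one _).2 h1
  rw [abs_le]; constructor <;> nlinarith [sq_nonneg (x k / ‖x‖)]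

theorem ang_mul_norm {x : E3} (h : x ≠ 0) :
    (fun y => ang y * ‖y‖) =ᶠ[𝓝 x] fun y : E3 => y 2 := by
  filter_upwards [isOpen_ne.mem_nhds h] with y hy
  exact div_mul_cancel₀ _ (norm_ne_zero_iff.2 hy)

theorem abs_pd_ang_le {x : E3} (h : x ≠ 0) (k : Fin 3) : |pd k ang x| ≤ 2 * ‖x‖⁻¹ := by
  have hr := norm_pos_iff.2 h
  have hn : ContDiffAt ℝ 2 (fun y : E3 => ‖y‖) x := contDiffAt_id.norm ℝ h
  have h1 := pd_congr_at (k := k) (ang_mul_norm h)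
  rw [pd_mul (contDiffAt_ang (n := 2) h).dAt hn.dAt, pd_coord] at h1
  have h2 : pd k ang x = ((if 2 = k then 1 else 0) - ang x * pd k (fun y => ‖y‖) x) * ‖x‖⁻¹ := by
    rw [← div_eq_mul_inv, eq_div_iff hr.ne']; linarith
  have h3 : |ang x * pd k (fun y => ‖y‖) x| ≤ 1 := by
    rw [abs_mul]
    exact mul_le_one₀ (abs_ang_le x) (abs_nonneg _) (abs_pd_norm_le h k)
  rw [h2, abs_mul, abs_inv, abs_norm]
  gcongr
  rw [abs_le] at h3 ⊢
  split_ifs <;> constructor <;> linarith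

theorem abs_pdd_ang_le {x : E3} (h : x ≠ 0) (k : Fin 3) : |pdd k ang x| ≤ 5 * ‖x‖⁻¹ ^ 2 := by
  have hr := norm_pos_iff.2 h
  have hn : ContDiffAt ℝ 2 (fun y : E3 => ‖y‖) x := contDiffAt_id.norm ℝ h
  -- Differentiating `ang · r = z` twice bounds the second derivative without expanding a quotient.
  have h1 := pdd_congr_at (k := k) (ang_mul_norm h)
  rw [pdd_mul (contDiffAt_ang h) hn, pdd_coord] at h1
  have h2 : pdd k ang x =
      -(2 * (pd k ang x * pd k (fun y => ‖y‖) x) + ang x * pdd k (fun y => ‖y‖) x) * ‖x‖⁻¹ := by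
    rw [← div_eq_mul_inv, eq_div_iff hr.ne']; linarith
  have h3 : |pd k ang x * pd k (fun y => ‖y‖) x| ≤ 2 * ‖x‖⁻¹ * 1 := by
    rw [abs_mul]
    exact mul_le_mul (abs_pd_ang_le h k) (abs_pd_norm_le h k) (abs_nonneg _) (by positivity)
  have h4 : |ang x * pdd k (fun y => ‖y‖) x| ≤ 1 * ‖x‖⁻¹ := by
    rw [abs_mul]
    exact mul_le_mul (abs_ang_le x) (abs_pdd_norm_le h k) (abs_nonneg _) zero_le_one
  rw [h2, abs_mul, abs_inv, abs_norm, show 5 * ‖x‖⁻¹ ^ 2 = 5 * ‖x‖⁻¹ * ‖x‖⁻¹ by ring]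
  gcongr
  rw [abs_le] at h3 h4 ⊢
  constructor <;> linarith

/-- A smooth step, which is `0` below `-1/2` and `1` above `1/2`. -/
def step (t : ℝ) : ℝ := Real.smoothTransition (t + 1 / 2)

theorem contDiff_step : ContDiff ℝ ((⊤ : ℕ∞) : WithTop ℕ∞) step :=
  Real.smoothTransition.contDiff.comp (contDiff_id.add contDiff_const)

theorem step_of_le {t : ℝ} (h : t ≤ -(1 / 2)) : step t = 0 :=
  Real.smoothTransition.zero_of_nonpos (by linarith)

theorem step_of_ge {t : ℝ} (h : 1 / 2 ≤ t) : step t = 1 :=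
  Real.smoothTransition.one_of_one_le (by linarith)

theorem hasDerivAt_step (t : ℝ) : HasDerivAt step (deriv step t) t :=
  (contDiff_step.differentiable (by simp) t).hasDerivAt

theorem contDiff_deriv_step : ContDiff ℝ ((⊤ : ℕ∞) : WithTop ℕ∞) (deriv step) :=
  ((contDiff_succ_iff_deriv (n := ((⊤ : ℕ∞) : WithTop ℕ∞))).1 contDiff_step).2.2

theorem hasDerivAt_deriv_step (t : ℝ) : HasDerivAt (deriv step) (deriv (deriv step) t) t :=
  (contDiff_deriv_step.differentiable (by simp) t).hasDerivAt

theorem step_eventuallyEq {t : ℝ} (h : 1 / 2 < |t|) : ∃ c : ℝ, step =ᶠ[𝓝 t] fun _ => c := by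
  rcases lt_abs.1 h with h | h
  · exact ⟨1, by filter_upwards [lt_mem_nhds h] with y hy using step_of_ge hy.le⟩
  · exact ⟨0, by
      filter_upwards [gt_mem_nhds (show t < -(1 / 2) by linarith)] with y hy
      exact step_of_le hy.le⟩

theorem exists_step_bound : ∃ K : ℝ, 0 ≤ K ∧ ∀ t, |t| ≤ 1 → |deriv step t| ≤ K ∧
    |deriv (deriv step) t| ≤ K := by
  have c1 : Continuous (deriv step) := contDiff_deriv_step.continuous
  have c2 : Continuous (deriv (deriv step)) :=
    (((contDiff_succ_iff_deriv (n := ((⊤ : ℕ∞) : WithTop ℕ∞))).1 contDiff_deriv_step).2.2).continuous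
  obtain ⟨K1, h1⟩ := (isCompact_Icc (a := (-1 : ℝ)) (b := 1)).exists_bound_of_continuousOn c1.continuousOn
  obtain ⟨K2, h2⟩ := (isCompact_Icc (a := (-1 : ℝ)) (b := 1)).exists_bound_of_continuousOn c2.continuousOn
  refine ⟨max (max K1 K2) 0, le_max_right _ _, fun t ht => ?_⟩
  have ht' : t ∈ Set.Icc (-1 : ℝ) 1 := abs_le.1 ht
  exact ⟨(h1 t ht').trans (by simp), (h2 t ht').trans (by simp)⟩

/-- An affine function of the smoothed angle. -/
def angFun (α β : ℝ) (x : E3) : ℝ := α + β * step (ang x)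

theorem contDiffAt_angFun {α β : ℝ} {x : E3} (h : x ≠ 0) :
    ContDiffAt ℝ ((⊤ : ℕ∞) : WithTop ℕ∞) (angFun α β) x :=
  contDiffAt_const.add (contDiffAt_const.mul (contDiff_step.contDiffAt.comp x (contDiffAt_ang h)))

/-- Homogeneity of degree zero costs one power of `r` per derivative. The second derivative gives `9
= 2² + 5`, from the constants `2` and `5` for the jets of `ang`. -/
theorem angFun_jets {α β K : ℝ} (hK : ∀ t, |t| ≤ 1 → |deriv step t| ≤ K ∧
    |deriv (deriv step) t| ≤ K) {x : E3} (h : x ≠ 0) (k : Fin 3) :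
    |pd k (angFun α β) x| ≤ |β| * (9 * K) * ‖x‖⁻¹ ∧
      |pdd k (angFun α β) x| ≤ |β| * (9 * K) * ‖x‖⁻¹ ^ 2 := by
  have hr := norm_pos_iff.2 h
  have sa : ContDiffAt ℝ 2 ang x := contDiffAt_ang h
  have ss : ContDiffAt ℝ 2 (fun y => step (ang y)) x :=
    (contDiff_step.of_le two_le_infty).contDiffAt.comp x sa
  obtain ⟨k1, k2⟩ := hK _ (abs_ang_le x)
  have hK0 : 0 ≤ K := (abs_nonneg _).trans k1
  have d1 := abs_pd_ang_le h k
  have d2 := abs_pdd_ang_le h k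
  unfold angFun
  constructor
  · rw [pd_add (differentiableAt_const _) (contDiffAt_const.mul ss).dAt, pd_const,
      pd_const_mul _ ss.dAt, pd_comp (hasDerivAt_step _) sa.dAt, zero_add, abs_mul, abs_mul]
    calc _ ≤ |β| * (K * (2 * ‖x‖⁻¹)) := by gcongr
      _ = |β| * (2 * K) * ‖x‖⁻¹ := by ring
      _ ≤ |β| * (9 * K) * ‖x‖⁻¹ := by gcongr; norm_num
  · rw [pdd_add contDiffAt_const (contDiffAt_const.mul ss), pdd_const,
      pdd_const_mul _ ss, pdd_comp (Filter.Eventually.of_forall hasDerivAt_step)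
      (hasDerivAt_deriv_step _) sa, zero_add, abs_mul, mul_assoc]
    gcongr
    refine (abs_add_le _ _).trans ?_
    rw [abs_mul, abs_mul, abs_pow]
    calc _ ≤ K * (2 * ‖x‖⁻¹) ^ 2 + K * (5 * ‖x‖⁻¹ ^ 2) := by gcongr
      _ = _ := by ring

theorem cone_zero_eq (s : ℝ) (x : E3) : cone s 0 x = (‖x‖ - s * x 2) / 2 := by
  have : axisPt 0 = 0 := by ext i; fin_cases i <;> simp
  rw [cone, this, sub_zero, sub_zero]

theorem cone_zero_ge {s : ℝ} (hs : s ^ 2 = 1) {x : E3} (h : x ≠ 0) (ha : |ang x| ≤ 1 / 2) :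
    ‖x‖ / 4 ≤ cone s 0 x := by
  have hr := norm_pos_iff.2 h
  rw [ang, abs_div, abs_norm, div_le_iff₀ hr] at ha
  have h1 : |s * x 2| = |x 2| := by
    rw [abs_mul, abs_eq_one_of_sq hs, one_mul]
  rw [cone_zero_eq]
  have := le_abs_self (s * x 2)
  linarith

theorem abs_pd_cone_le {s : ℝ} (hs : s ^ 2 = 1) {x : E3} {t : ℝ} (h : x ≠ axisPt t) (k : Fin 3) :
    |pd k (cone s t) x| ≤ 1 := by
  have h1 : |(x k - axisPt t k) / ‖x - axisPt t‖| ≤ 1 := by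
    rw [abs_div, abs_norm]
    exact div_le_one_of_le₀ (by simpa using abs_coord_le k (x - axisPt t)) (norm_nonneg _)
  have h2 : |s| = 1 := abs_eq_one_of_sq hs
  rw [pd_cone h]
  rw [abs_le] at h1 ⊢
  have h3 := abs_le.1 h2.le
  split_ifs <;> constructor <;> linarith

/-- In the sector `|cos θ| ≤ 1/2` both diagonal entries are at least `r/4`, so the power counting
applies. Outside it `ω` is locally constant and the tension vanishes. The sign `s` covers both
labellings of the semi-infinite rods with one constant. -/
theorem exists_tensionNorm_decay (α β : Fin 2 → ℝ) : ∃ C : ℝ, 0 ≤ C ∧ ∀ (s : ℝ), s ^ 2 = 1 →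
    ∀ (F : E3 → Matrix (Fin 2) (Fin 2) ℝ) (ω : E3 → Fin 2 → ℝ) (x : E3), rsq x ≠ 0 → 1 ≤ ‖x‖ →
    (∀ᶠ y in 𝓝 x, F y = !![cone s 0 y, 0; 0, cone (-s) 0 y]) →
    (∀ᶠ y in 𝓝 x, ∀ i, ω y i = angFun (α i) (β i) y) →
    tensionNorm (fun y => param (F y) (ω y)) x ≤ C * ‖x‖ ^ (-(7 / 2) : ℝ) := by
  obtain ⟨K, hK0, hK⟩ := exists_step_bound
  set M := max |β 0| |β 1| * (9 * K) with hM
  set C0 := 6 * (192 * M ^ 2) ^ 2 + 256 * (39 * M) ^ 2 + 2 * 64 ^ 2 * (3 * M ^ 2) ^ 2 with hC0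
  have hC0' : 0 ≤ C0 := by positivity
  refine ⟨Real.sqrt C0, Real.sqrt_nonneg _, fun s hs F ω x hx h1 hF hω => ?_⟩
  have h0 : x ≠ 0 := fun h => by rw [h, norm_zero] at h1; linarith
  have hr := norm_pos_iff.2 h0
  have hs' : (-s) ^ 2 = 1 := by rw [neg_sq, hs]
  have hn := ne_axisPt_of_rsq hx 0
  have A0 := cone_pos_of_rsq hs 0 hx
  have B0 := cone_pos_of_rsq hs' 0 hx
  have sA : ContDiffAt ℝ 2 (cone s 0) x := contDiffAt_cone hn
  have sB : ContDiffAt ℝ 2 (cone (-s) 0) x := contDiffAt_cone hn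
  have LA := sA.log A0.ne'
  have LB := sB.log B0.ne'
  have sw : ∀ i, ContDiffAt ℝ 2 (angFun (-α i) (-β i)) x := fun i =>
    (contDiffAt_angFun h0).of_le two_le_infty
  have key := tensionNorm_sq_eq (Φ := fun y => param (F y) (ω y)) (x := x)
    (u₀ := fun y => -(Real.log (cone s 0 y) + Real.log (cone (-s) 0 y)))
    (u₁ := fun y => Real.log (cone s 0 y)) (u₂ := fun y => Real.log (cone (-s) 0 y))
    -- The parametrization is already horospherical with `(a, b) = -ω`, so no change of frame is
    -- needed.
    (a := angFun (-α 0) (-β 0)) (b := angFun (-α 1) (-β 1)) 1 (by simp) ?_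
    (LA.add LB).neg LA LB (sw 0) (sw 1)
  · have l₁ := lap_log_cone hs hn A0.ne'
    have l₂ := lap_log_cone hs' hn B0.ne'
    have l₀ : lap (fun y => -(Real.log (cone s 0 y) + Real.log (cone (-s) 0 y))) x = 0 := by
      rw [lap_neg (LA.add LB), lap_add LA LB, l₁, l₂]; simp
    have hrpow : (‖x‖⁻¹ ^ 7) = (‖x‖ ^ (-(7 / 2) : ℝ)) ^ 2 := by
      rw [← Real.rpow_natCast (‖x‖ ^ (-(7 / 2) : ℝ)), ← Real.rpow_mul hr.le,
        ← Real.rpow_natCast, ← Real.rpow_neg_one, ← Real.rpow_mul hr.le]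
      norm_num
    have goal : tensionNorm (fun y => param (F y) (ω y)) x ^ 2 ≤ C0 * ‖x‖⁻¹ ^ 7 := by
      rw [key]
      -- Near the axis one entry of `F` is small and the weights `exp (u₀ - uᵢ)` are uncontrolled;
      -- there the step function must be constant.
      by_cases hang : |ang x| ≤ 1 / 2
      · have gA := cone_zero_ge hs h0 hang
        have gB := cone_zero_ge hs' h0 hang
        have dl : ∀ s' : ℝ, s' ^ 2 = 1 → ∀ k, |pd k (fun y => Real.log (cone s' 0 y)) x| ≤
            4 * ‖x‖⁻¹ := fun s' hs' k => by
          have g := cone_zero_ge hs' h0 hang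
          have g0 := cone_pos_of_rsq hs' 0 hx
          rw [pd_log (contDiffAt_cone hn) g0.ne', abs_div, abs_of_pos g0, div_le_iff₀ g0]
          refine (abs_pd_cone_le hs' hn k).trans ?_
          have : 1 = 4 * ‖x‖⁻¹ * (‖x‖ / 4) := by field_simp
          rw [this]
          gcongr
        have d1 := dl s hs
        have d2 := dl (-s) hs'
        have ex : Real.exp (-(Real.log (cone s 0 x) + Real.log (cone (-s) 0 x))) =
            (cone s 0 x)⁻¹ * (cone (-s) 0 x)⁻¹ := by
          rw [Real.exp_neg, Real.exp_add, Real.exp_log A0, Real.exp_log B0, mul_inv]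
        have iA : (cone s 0 x)⁻¹ ≤ 4 * ‖x‖⁻¹ := by
          rw [show 4 * ‖x‖⁻¹ = (‖x‖ / 4)⁻¹ by field_simp]
          exact inv_anti₀ (by positivity) gA
        have iB : (cone (-s) 0 x)⁻¹ ≤ 4 * ‖x‖⁻¹ := by
          rw [show 4 * ‖x‖⁻¹ = (‖x‖ / 4)⁻¹ by field_simp]
          exact inv_anti₀ (by positivity) gB
        have jet : ∀ i k, |pd k (angFun (-α i) (-β i)) x| ≤ M * ‖x‖⁻¹ ∧
            |pdd k (angFun (-α i) (-β i)) x| ≤ M * ‖x‖⁻¹ ^ 2 := fun i k => by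
          have j := angFun_jets (α := -α i) (β := -β i) hK h0 k
          have hb : |-β i| * (9 * K) ≤ M := by
            rw [hM, abs_neg]
            gcongr
            fin_cases i <;> simp
          exact ⟨j.1.trans (by gcongr), j.2.trans (by gcongr)⟩
        refine horoTensionSq_le (inv_nonneg.2 hr.le) (inv_le_one_of_one_le₀ h1) l₀ l₁ l₂ ?_ d1 d2
          (fun k => (jet 0 k).1) (fun k => (jet 1 k).1) (fun k => (jet 0 k).2)
          (fun k => (jet 1 k).2) ?_ ?_
        · intro k
          have : (fun y => -(Real.log (cone s 0 y) + Real.log (cone (-s) 0 y))) =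
              fun y => (-1) * (Real.log (cone s 0 y) + Real.log (cone (-s) 0 y)) :=
            funext fun y => by ring
          rw [this, pd_const_mul _ (LA.add LB).dAt, pd_add LA.dAt LB.dAt]
          have e1 := abs_le.1 (d1 k)
          have e2 := abs_le.1 (d2 k)
          rw [abs_le]; constructor <;> linarith
        · rw [Real.exp_sub, ex, Real.exp_log A0, div_eq_mul_inv]
          calc _ ≤ 4 * ‖x‖⁻¹ * (4 * ‖x‖⁻¹) * (4 * ‖x‖⁻¹) := by gcongr
            _ = _ := by ring
        · rw [Real.exp_sub, ex, Real.exp_log B0, div_eq_mul_inv]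
          calc _ ≤ 4 * ‖x‖⁻¹ * (4 * ‖x‖⁻¹) * (4 * ‖x‖⁻¹) := by gcongr
            _ = _ := by ring
      · obtain ⟨c, hc⟩ := step_eventuallyEq (not_le.1 hang)
        have hconst : ∀ α β, angFun α β =ᶠ[𝓝 x] fun _ => α + β * c := fun α β => by
          filter_upwards [(contDiffAt_ang (n := 2) h0).continuousAt.eventually hc] with y hy
          rw [angFun, hy]
        have zp : ∀ α β k, pd k (angFun α β) x = 0 := fun α β k => by
          rw [pd_congr_at (hconst α β), pd_const]
        have zl : ∀ α β, lap (angFun α β) x = 0 := fun α β => by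
          rw [lap_congr_at (hconst α β), lap_const]
        simp only [horoTensionSq, l₀, l₁, l₂, gradInner, zp, zl]
        simp
        positivity
    rw [hrpow] at goal
    have e : (Real.sqrt C0 * ‖x‖ ^ (-(7 / 2) : ℝ)) ^ 2 = C0 * (‖x‖ ^ (-(7 / 2) : ℝ)) ^ 2 := by
      rw [mul_pow, Real.sq_sqrt hC0']
    exact abs_le_of_sq_le_sq' (goal.trans_eq e.symm) (by positivity) |>.2
  · have cpos : ∀ s', s' ^ 2 = 1 → ∀ᶠ y in 𝓝 x, 0 < cone s' 0 y := fun s' hs' =>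
      (continuous_cone s' 0).continuousAt.eventually (lt_mem_nhds (cone_pos_of_rsq hs' 0 hx))
    filter_upwards [hF, hω, cpos s hs, cpos (-s) hs'] with y e1 e2 e3 e4
    have hex : Real.exp (-(Real.log (cone s 0 y) + Real.log (cone (-s) 0 y))) =
        (cone s 0 y * cone (-s) 0 y)⁻¹ := by
      rw [Real.exp_neg, Real.exp_add, Real.exp_log e3, Real.exp_log e4]
    have en : ∀ i, angFun (-α i) (-β i) y = -ω y i := fun i => by
      rw [e2, angFun, angFun]; ring
    rw [param, e1, horo, hex, Real.exp_log e3, Real.exp_log e4, en, en]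
    ext i j
    fin_cases i <;> fin_cases j <;> simp [Matrix.det_fin_two] <;> ring

namespace RodData

variable (D : RodData)

/-! ### Rods -/

theorem eq_or_mem_openRod (t : ℝ) : (∃ i, t = D.z i) ∨ ∃ l, t ∈ D.openRod l := by
  by_cases h : ∃ i, D.z i ≤ t
  · obtain ⟨i, hi, hmin⟩ : ∃ i, D.z i ≤ t ∧ ∀ j, j < i → t < D.z j := by
      classical
      -- Heights decrease with the index, so the least such index is the first point at or below
      -- `t`.
      obtain ⟨i, hi⟩ := Finset.exists_minimal (s := Finset.univ.filter fun i => D.z i ≤ t)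
        (h.imp fun i hi => by simpa using hi)
      refine ⟨i, by simpa using hi.1, fun j hj => ?_⟩
      by_contra hc
      exact absurd (hi.2 (by simpa using hc) hj.le) (not_le.2 hj)
    rcases hi.eq_or_lt with h | h
    · exact Or.inl ⟨i, h.symm⟩
    · refine Or.inr ⟨i.castSucc, fun j hj => hmin j (by simpa using hj), fun j hj => ?_⟩
      exact (D.z_strictAnti.antitone (by simpa using hj)).trans_lt h
  · push Not at h
    exact Or.inr ⟨Fin.last _, fun j _ => h j, fun j hj =>
      absurd hj (not_le.2 (Fin.castSucc_lt_last j))⟩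

theorem openRod_subset_rod (l : Fin (D.L + 1)) : D.openRod l ⊆ D.rod l :=
  fun _ ht => ⟨fun i hi => (ht.1 i hi).le, fun i hi => (ht.2 i hi).le⟩

theorem z_notMem_openRod (i : Fin D.L) (l : Fin (D.L + 1)) : D.z i ∉ D.openRod l := by
  intro h
  rcases lt_or_ge i.castSucc l with hl | hl
  · exact lt_irrefl _ (h.1 i hl)
  · exact lt_irrefl _ (h.2 i hl)

theorem not_lt_of_mem_openRod {t : ℝ} {l l' : Fin (D.L + 1)} (h : t ∈ D.openRod l)
    (h' : t ∈ D.openRod l') : ¬ l < l' := by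
  intro hl
  obtain ⟨j, rfl⟩ := Fin.exists_castSucc_eq.2 (hl.trans_le (Fin.le_last l')).ne
  exact lt_asymm (h.2 j le_rfl) (h'.1 j hl)

theorem openRod_disjoint {t : ℝ} {l l' : Fin (D.L + 1)} (h : t ∈ D.openRod l)
    (h' : t ∈ D.openRod l') : l = l' :=
  le_antisymm (not_lt.1 (D.not_lt_of_mem_openRod h' h)) (not_lt.1 (D.not_lt_of_mem_openRod h h'))

theorem isOpen_openRod (l : Fin (D.L + 1)) : IsOpen (D.openRod l) := by
  have : D.openRod l = (⋂ i : Fin D.L, {t | i.castSucc < l → t < D.z i}) ∩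
      ⋂ i : Fin D.L, {t | l ≤ i.castSucc → D.z i < t} := by
    ext t; simp [openRod]
  rw [this]
  refine (isOpen_iInter_of_finite fun i => ?_).inter (isOpen_iInter_of_finite fun i => ?_)
  · by_cases h : i.castSucc < l
    · simp only [h, true_imp_iff]; exact isOpen_Iio
    · simp [h]
  · by_cases h : l ≤ i.castSucc
    · simp only [h, true_imp_iff]; exact isOpen_Ioi
    · simp [h]

/-- The rod above the piece `i`; the piece `none` is the asymptotic region. -/
def upRod : Option (Fin D.L) → Fin (D.L + 1)
  | none => 0
  | some i => i.castSucc

/-- The rod below the piece `i`. -/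
def lowRod : Option (Fin D.L) → Fin (D.L + 1)
  | none => Fin.last D.L
  | some i => i.succ

/-- The height of the centre of the piece `i`. -/
def height : Option (Fin D.L) → ℝ
  | none => 0
  | some i => D.z i

theorem isAxis_zero : D.IsAxis 0 := by
  rintro ⟨h1, h2⟩
  rcases D.ends with h | h <;> simp [h1, h2] at h

theorem isAxis_last : D.IsAxis (Fin.last D.L) := by
  rintro ⟨h1, h2⟩
  rcases D.ends with h | h <;> simp [h1, h2] at h

theorem isAxis_up_or_low (i : Option (Fin D.L)) : D.IsAxis (D.upRod i) ∨ D.IsAxis (D.lowRod i) := by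
  rcases i with _ | i
  · exact Or.inl D.isAxis_zero
  · exact D.corner_or_pole i

/-- With no points there would be a single rod, carrying the two distinct end structures at once. -/
theorem L_pos : 0 < D.L := by
  rcases Nat.eq_zero_or_pos D.L with h | h
  · exfalso
    have e : Fin.last D.L = 0 := Fin.ext h
    have := D.ends
    rw [e] at this
    rcases this with ⟨h1, -, h3, -⟩ | ⟨h1, -, h3, -⟩ <;> simp_all
  · exact h

theorem dir_ne_zero {l : Fin (D.L + 1)} (h : D.IsAxis l) : D.dir l ≠ 0 := by
  intro h0
  apply h
  have h1 := congrFun h0 0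
  have h2 := congrFun h0 1
  simp only [dir] at h1 h2
  exact ⟨by simpa using h1, by simpa using h2⟩

open scoped Classical in
/-- The direction degenerating above the centre of the piece `i`, or a substitute for it. -/
def upDir (i : Option (Fin D.L)) : Fin 2 → ℝ :=
  if D.IsAxis (D.upRod i) then D.dir (D.upRod i) else perp (D.dir (D.lowRod i))

open scoped Classical in
/-- The direction degenerating below the centre of the piece `i`, or a substitute for it. -/
def lowDir (i : Option (Fin D.L)) : Fin 2 → ℝ :=
  if D.IsAxis (D.lowRod i) then D.dir (D.lowRod i) else perp (D.dir (D.upRod i))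

theorem sq_add_sq_ne_zero {v : Fin 2 → ℝ} (hv : v ≠ 0) : v 0 * v 0 + v 1 * v 1 ≠ 0 := by
  intro h0
  apply hv
  have h1 : v 0 = 0 := by nlinarith [mul_self_nonneg (v 0), mul_self_nonneg (v 1)]
  have h2 : v 1 = 0 := by nlinarith [mul_self_nonneg (v 0), mul_self_nonneg (v 1)]
  ext i; fin_cases i <;> simp [h1, h2]

/-- At a corner this is the corner condition, for the asymptotic piece the condition on the ends; at
a pole the substitute direction is perpendicular to the other one, and the determinant is a sum of
squares. -/
theorem det_dir_ne_zero (i : Option (Fin D.L)) :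
    D.upDir i 0 * D.lowDir i 1 - D.upDir i 1 * D.lowDir i 0 ≠ 0 := by
  unfold upDir lowDir
  by_cases hu : D.IsAxis (D.upRod i) <;> by_cases hl : D.IsAxis (D.lowRod i)
  · rw [if_pos hu, if_pos hl]
    rcases i with _ | i
    · simp only [upRod, lowRod, dir]
      rcases D.ends with ⟨h1, h2, h3, h4⟩ | ⟨h1, h2, h3, h4⟩
      · have h5 : D.m 0 ≠ 0 := fun h => by simp [h] at h1
        have h6 : D.n (Fin.last D.L) ≠ 0 := fun h => by simp [h] at h4
        simp [h2, h5, h6]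
      · have h5 : D.n 0 ≠ 0 := fun h => by simp [h] at h2
        have h6 : D.m (Fin.last D.L) ≠ 0 := fun h => by simp [h] at h3
        simp [h1, h5, h6]
    · have := D.corner_det i hu hl
      simp only [upRod, lowRod, dir]
      simp
      exact_mod_cast this
  · rw [if_pos hu, if_neg hl]
    have := sq_add_sq_ne_zero (D.dir_ne_zero hu)
    simpa [perp] using this
  · rw [if_neg hu, if_pos hl]
    have := sq_add_sq_ne_zero (D.dir_ne_zero hl)
    intro h
    apply this
    simp [perp] at h
    linarith
  · exact absurd (D.isAxis_up_or_low i) (by simp [hu, hl])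

/-! ### Partition of unity -/

/-- The region in which the piece `i` is used. -/
def region (R : ℝ) : Option (Fin D.L) → Set E3
  | none => {x | R < ‖x‖}
  | some i => {x | ‖x‖ < R + 1 ∧ (∀ j, j < i → x 2 < D.z j) ∧ ∀ j, i < j → D.z j < x 2}

theorem isOpen_region (R : ℝ) (i : Option (Fin D.L)) : IsOpen (D.region R i) := by
  rcases i with _ | i
  · exact isOpen_lt continuous_const continuous_norm
  · have hc : Continuous fun x : E3 => x 2 := (contDiff_coord (n := 0) 2).continuous
    have : D.region R (some i) = {x | ‖x‖ < R + 1} ∩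
        ((⋂ j : Fin D.L, {x | j < i → x 2 < D.z j}) ∩ ⋂ j : Fin D.L, {x | i < j → D.z j < x 2}) := by
      ext x; simp [region]
    rw [this]
    refine (isOpen_lt continuous_norm continuous_const).inter
      ((isOpen_iInter_of_finite fun j => ?_).inter (isOpen_iInter_of_finite fun j => ?_))
    · by_cases h : j < i
      · simpa [h] using isOpen_lt hc continuous_const
      · simp [h]
    · by_cases h : i < j
      · simpa [h] using isOpen_lt continuous_const hc
      · simp [h]

theorem exists_mem_region (R : ℝ) (x : E3) : ∃ i, x ∈ D.region R i := by
  by_cases hx : R < ‖x‖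
  · exact ⟨none, hx⟩
  have hx' : ‖x‖ < R + 1 := by linarith
  rcases D.eq_or_mem_openRod (x 2) with ⟨i, hi⟩ | ⟨l, hl⟩
  · exact ⟨some i, hx', fun j hj => by rw [hi]; exact D.z_strictAnti hj,
      fun j hj => by rw [hi]; exact D.z_strictAnti hj⟩
  · rcases Fin.eq_castSucc_or_eq_last l with ⟨i, rfl⟩ | rfl
    · exact ⟨some i, hx', fun j hj => hl.1 j (by simpa using hj),
        fun j hj => hl.2 j (by simpa using hj.le)⟩
    -- Each rod is assigned to the point at its lower end; the bottom rod has none and goes to the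
    -- lowest point.
    · exact ⟨some ⟨D.L - 1, Nat.sub_lt D.L_pos one_pos⟩, hx',
        fun j _ => hl.1 j (Fin.castSucc_lt_last j), fun j hj => by
          have h1 : D.L - 1 < (j : ℕ) := hj
          have h2 := j.2
          omega⟩

/-- A partition of unity adapted to the rod data. -/
structure Cutoffs where
  /-- the radius of a ball containing all corners and poles -/
  R : ℝ
  R_nonneg : 0 ≤ R
  le_R : ∀ j, |D.z j| ≤ R
  /-- the cutoff functions -/
  χ : Option (Fin D.L) → E3 → ℝ
  smooth : ∀ i, ContDiff ℝ ((⊤ : ℕ∞) : WithTop ℕ∞) (χ i)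
  nonneg : ∀ i x, 0 ≤ χ i x
  sum_eq : ∀ x, ∑ i, χ i x = 1
  supp : ∀ i, tsupport (χ i) ⊆ D.region R i

theorem nonempty_cutoffs : Nonempty D.Cutoffs := by
  -- Any nonnegative bound for all `|z j|` would do.
  set R : ℝ := ∑ j, |D.z j| with hR
  obtain ⟨f, hf⟩ := SmoothPartitionOfUnity.exists_isSubordinate 𝓘(ℝ, E3) (s := (Set.univ : Set E3))
    isClosed_univ (D.region R) (D.isOpen_region R)
    (fun x _ => Set.mem_iUnion.2 (D.exists_mem_region R x))
  refine ⟨⟨R, Finset.sum_nonneg fun _ _ => abs_nonneg _,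
    fun j => Finset.single_le_sum (f := fun j => |D.z j|) (fun _ _ => abs_nonneg _)
      (Finset.mem_univ j),
    fun i => f i, fun i => ?_, fun i x => f.nonneg i x, fun x => ?_, fun i => hf i⟩⟩
  · exact contMDiff_iff_contDiff.1 (f i).contMDiff
  · rw [← finsum_eq_sum_of_fintype]
    exact f.sum_eq_one (Set.mem_univ x)

/-! ### Rods met by a region, and the complement of `Γ`. -/

variable {D}

/-- This locality makes the gluing consistent. The region of `z i` stops before the neighbouring
points, and beyond radius `R` the axis contains only the semi-infinite rods. The height inequality
puts the point on the side where the coefficient of that rod degenerates. -/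
theorem rod_of_mem_region (P : D.Cutoffs) {i : Option (Fin D.L)} {t : ℝ}
    (hx : axisPt t ∈ D.region P.R i) {l : Fin (D.L + 1)} (ht : t ∈ D.rod l) :
    (l = D.upRod i ∧ D.height i ≤ t) ∨ (l = D.lowRod i ∧ t ≤ D.height i) := by
  rcases i with _ | i
  · have hn : ‖axisPt t‖ = |t| := by
      rw [← abs_norm, ← sq_eq_sq_iff_abs_eq_abs, norm_sq_eq]; simp
    have h : P.R < |t| := by rw [← hn]; exact hx
    rcases lt_abs.1 h with h | h
    · left
      refine ⟨?_, (P.R_nonneg.trans_lt h).le⟩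
      by_contra hl
      have hl' : (⟨0, D.L_pos⟩ : Fin D.L).castSucc < l := Fin.pos_of_ne_zero hl
      have h1 := ht.1 _ hl'
      have h2 := (abs_le.1 (P.le_R ⟨0, D.L_pos⟩)).2
      linarith
    · right
      refine ⟨?_, by have := P.R_nonneg; simp only [height]; linarith⟩
      by_contra hl
      obtain ⟨j, rfl⟩ := Fin.exists_castSucc_eq.2 hl
      have h1 := ht.2 j le_rfl
      have h2 := (abs_le.1 (P.le_R j)).1
      linarith
  · obtain ⟨-, h1, h2⟩ := hx
    simp only [axisPt_two] at h1 h2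
    rcases lt_trichotomy l i.castSucc with h | h | h
    · exfalso
      obtain ⟨j, rfl⟩ := Fin.exists_castSucc_eq.2 (h.trans_le (Fin.le_last _)).ne
      exact absurd (ht.2 j le_rfl) (not_le.2 (h1 j (by simpa using h)))
    · exact Or.inl ⟨h, ht.2 i h.le⟩
    · right
      refine ⟨?_, ht.1 i h⟩
      by_contra hne
      have hs : i.succ < l := lt_of_le_of_ne (Fin.castSucc_lt_iff_succ_le.1 h) (Ne.symm hne)
      have hlt : (i : ℕ) + 1 < D.L := by
        have h3 : (i : ℕ) + 1 < l := hs
        have h4 := l.2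
        omega
      have hj : (⟨i + 1, hlt⟩ : Fin D.L).castSucc < l := hs
      exact absurd (ht.1 _ hj) (not_le.2 (h2 ⟨i + 1, hlt⟩ (Nat.lt_succ_self i)))

theorem openRod_of_mem_region (P : D.Cutoffs) {i : Option (Fin D.L)} {t : ℝ}
    (hx : axisPt t ∈ D.region P.R i) {l : Fin (D.L + 1)} (ht : t ∈ D.openRod l) :
    (l = D.upRod i ∧ D.height i < t) ∨ (l = D.lowRod i ∧ t < D.height i) := by
  have hne : t ≠ D.height i := by
    rintro rfl
    rcases i with _ | i
    · have h1 : P.R < ‖axisPt (D.height none)‖ := hx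
      have h2 : ‖axisPt (D.height none)‖ = 0 := by
        rw [norm_eq_zero, eq_comm, eq_axisPt_iff]
        simp [rsq, height]
      linarith [P.R_nonneg]
    · exact D.z_notMem_openRod i l ht
  rcases rod_of_mem_region P hx (D.openRod_subset_rod l ht) with h | h
  · exact Or.inl ⟨h.1, h.2.lt_of_ne' hne⟩
  · exact Or.inr ⟨h.1, h.2.lt_of_ne hne⟩

theorem eq_axisPt_of_rsq {x : E3} (h : rsq x = 0) : x = axisPt (x 2) := (eq_axisPt_iff x _).2 ⟨h, rfl⟩

theorem rsq_eq_zero_iff (x : E3) : rsq x = 0 ↔ x 0 = 0 ∧ x 1 = 0 := by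
  unfold rsq
  constructor
  · intro h
    exact ⟨by nlinarith [sq_nonneg (x 0), sq_nonneg (x 1)],
      by nlinarith [sq_nonneg (x 0), sq_nonneg (x 1)]⟩
  · rintro ⟨h1, h2⟩; rw [h1, h2]; ring

theorem isClosed_gam (D : RodData) : IsClosed D.Gam := by
  have hc : ∀ k, Continuous fun x : E3 => x k := fun k => (contDiff_coord (n := 0) k).continuous
  have : D.Gam = {x | x 0 = 0} ∩ ({x | x 1 = 0} ∩
      ⋂ l : Fin (D.L + 1), {x | ¬ D.IsAxis l → x 2 ∉ D.openRod l}) := by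
    ext x; simp [Gam]
  rw [this]
  refine (isClosed_eq (hc 0) continuous_const).inter ((isClosed_eq (hc 1) continuous_const).inter
    (isClosed_iInter fun l => ?_))
  by_cases h : D.IsAxis l
  · simp [h]
  · simp only [h, not_false_eq_true, true_imp_iff]
    exact ((D.isOpen_openRod l).preimage (hc 2)).isClosed_compl

theorem exists_of_notMem_gam {x : E3} (hx : x ∈ D.Gamᶜ) (h : rsq x = 0) :
    ∃ l, ¬ D.IsAxis l ∧ x 2 ∈ D.openRod l := by
  by_contra hc
  push Not at hc
  obtain ⟨h0, h1⟩ := (rsq_eq_zero_iff x).1 h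
  exact hx ⟨h0, h1, hc⟩

theorem mem_gam_cases {x : E3} (hx : x ∈ D.Gam) : rsq x = 0 ∧
    ((∃ i, x = axisPt (D.z i)) ∨ ∃ l, D.IsAxis l ∧ x 2 ∈ D.openRod l) := by
  have h := (rsq_eq_zero_iff x).2 ⟨hx.1, hx.2.1⟩
  refine ⟨h, ?_⟩
  rcases D.eq_or_mem_openRod (x 2) with ⟨i, hi⟩ | ⟨l, hl⟩
  · exact Or.inl ⟨i, (eq_axisPt_iff _ _).2 ⟨h, hi⟩⟩
  · exact Or.inr ⟨l, by_contra fun hn => hx.2.2 l hn hl, hl⟩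

end RodData

namespace RodData

variable (D : RodData)

/-! ### The pieces of the model map -/

open scoped Classical in
/-- The coefficient vanishing on the upper rod. -/
def upCoef (i : Option (Fin D.L)) : E3 → ℝ :=
  if D.IsAxis (D.upRod i) then cone 1 (D.height i) else fun _ => 1

open scoped Classical in
/-- The coefficient vanishing on the lower rod. -/
def lowCoef (i : Option (Fin D.L)) : E3 → ℝ :=
  if D.IsAxis (D.lowRod i) then cone (-1) (D.height i) else fun _ => 1

/-- The matrix `F` of the piece `i`. -/
def piece (i : Option (Fin D.L)) (x : E3) (a b : Fin 2) : ℝ :=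
  D.upCoef i x * (perp (D.lowDir i) a * perp (D.lowDir i) b) +
    D.lowCoef i x * (perp (D.upDir i) a * perp (D.upDir i) b)

open scoped Classical in
/-- The potential of the piece `i`. -/
def potential : Option (Fin D.L) → E3 → Fin 2 → ℝ
  | none => fun x a => angFun (D.c (Fin.last D.L) a) (D.c 0 a - D.c (Fin.last D.L) a) x
  | some i => fun _ => if D.IsAxis i.castSucc then D.c i.castSucc else D.c i.succ

variable {D} (P : D.Cutoffs)

namespace Cutoffs

/-- The matrix `F` of the model map. -/
def F (x : E3) : Matrix (Fin 2) (Fin 2) ℝ := Matrix.of fun a b => ∑ i, P.χ i x * D.piece i x a b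

/-- The potential of the model map. -/
def ω (x : E3) (a : Fin 2) : ℝ := ∑ i, P.χ i x * D.potential i x a

/-- The model map. -/
def Φ (x : E3) : Matrix (Fin 3) (Fin 3) ℝ := param (P.F x) (P.ω x)

theorem F_apply (x : E3) (a b : Fin 2) : P.F x a b = ∑ i, P.χ i x * D.piece i x a b := rfl

end Cutoffs

/-! ### Regularity and positivity of the glued matrix. -/

theorem continuous_upCoef (i : Option (Fin D.L)) : Continuous (D.upCoef i) := by
  unfold upCoef
  split_ifs
  · exact continuous_cone _ _
  · exact continuous_const

theorem continuous_lowCoef (i : Option (Fin D.L)) : Continuous (D.lowCoef i) := by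
  unfold lowCoef
  split_ifs
  · exact continuous_cone _ _
  · exact continuous_const

theorem continuous_piece (i : Option (Fin D.L)) (a b : Fin 2) :
    Continuous fun x => D.piece i x a b :=
  ((continuous_upCoef i).mul continuous_const).add ((continuous_lowCoef i).mul continuous_const)

/-- Positivity, smoothness and log-harmonicity of a coefficient. -/
structure Harmonic (g : E3 → ℝ) (x : E3) : Prop where
  pos : 0 < g x
  smooth : ContDiffAt ℝ ((⊤ : ℕ∞) : WithTop ℕ∞) g x
  lap : lap (fun y => Real.log (g y)) x = 0

theorem harmonic_one (x : E3) : Harmonic (fun _ => 1) x :=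
  ⟨one_pos, contDiffAt_const, lap_const _ _⟩

theorem harmonic_cone {s t : ℝ} (hs : s ^ 2 = 1) {x : E3} (hx : x ≠ axisPt t)
    (h : 0 < cone s t x) : Harmonic (cone s t) x :=
  ⟨h, contDiffAt_cone hx, lap_log_cone hs hx h.ne'⟩

/-- Off the axis every cone function is positive. On an adjacent horizon rod the coefficient of that
side is `1`, and the other cone function vanishes only beyond the centre. -/
theorem harmonic_coef {i : Option (Fin D.L)} {x : E3} (hi : x ∈ D.region P.R i) (hx : x ∈ D.Gamᶜ) :
    Harmonic (D.upCoef i) x ∧ Harmonic (D.lowCoef i) x := by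
  by_cases hr : rsq x = 0
  · obtain ⟨l, hl, ht⟩ := exists_of_notMem_gam hx hr
    have hi' : axisPt (x 2) ∈ D.region P.R i := by rwa [← eq_axisPt_of_rsq hr]
    rcases openRod_of_mem_region P hi' ht with ⟨rfl, h⟩ | ⟨rfl, h⟩
    · have hlow := (D.isAxis_up_or_low i).resolve_left hl
      rw [upCoef, if_neg hl, lowCoef, if_pos hlow]
      exact ⟨harmonic_one x, harmonic_cone (by norm_num)
        (fun h0 => h.ne' ((eq_axisPt_iff _ _).1 h0).2) (cone_pos_of_height (by linarith))⟩
    · have hup := (D.isAxis_up_or_low i).resolve_right hl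
      rw [upCoef, if_pos hup, lowCoef, if_neg hl]
      exact ⟨harmonic_cone (by norm_num)
        (fun h0 => h.ne ((eq_axisPt_iff _ _).1 h0).2) (cone_pos_of_height (by linarith)),
        harmonic_one x⟩
  · have hc : ∀ s : ℝ, s ^ 2 = 1 → Harmonic (cone s (D.height i)) x := fun s hs =>
      harmonic_cone hs (ne_axisPt_of_rsq hr _) (cone_pos_of_rsq hs _ hr)
    constructor
    · unfold upCoef
      split_ifs
      · exact hc 1 (by norm_num)
      · exact harmonic_one x
    · unfold lowCoef
      split_ifs
      · exact hc (-1) (by norm_num)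
      · exact harmonic_one x

namespace Cutoffs

/-- Singularities of a piece outside its region are invisible, as the cutoff vanishes near every
point outside its closed support. -/
theorem contDiffAt_mul {n : WithTop ℕ∞} (hn : n ≤ ((⊤ : ℕ∞) : WithTop ℕ∞)) {i : Option (Fin D.L)}
    {f : E3 → ℝ} {x : E3} (h : x ∈ D.region P.R i → ContDiffAt ℝ n f x) :
    ContDiffAt ℝ n (fun y => P.χ i y * f y) x := by
  by_cases hx : x ∈ tsupport (P.χ i)
  · exact ((P.smooth i).of_le hn).contDiffAt.mul (h (P.supp i hx))
  · refine (contDiffAt_const (c := (0 : ℝ))).congr_of_eventuallyEq ?_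
    filter_upwards [notMem_tsupport_iff_eventuallyEq.1 hx] with y hy
    simp [hy]

theorem mem_region_of_ne {i : Option (Fin D.L)} {x : E3} (h : P.χ i x ≠ 0) : x ∈ D.region P.R i :=
  P.supp i (subset_tsupport _ h)

theorem exists_pos (x : E3) : ∃ i, 0 < P.χ i x := by
  by_contra hc
  push Not at hc
  have h := P.sum_eq x
  rw [Finset.sum_eq_zero fun i _ => le_antisymm (hc i) (P.nonneg i x)] at h
  exact zero_ne_one h

theorem contDiff_ω (a : Fin 2) :
    ContDiff ℝ ((⊤ : ℕ∞) : WithTop ℕ∞) fun x => P.ω x a := by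
  rw [contDiff_iff_contDiffAt]
  intro x
  refine ContDiffAt.sum fun i _ => P.contDiffAt_mul le_rfl fun hi => ?_
  rcases i with _ | i
  · refine contDiffAt_angFun ?_
    rintro rfl
    have : P.R < ‖(0 : E3)‖ := hi
    rw [norm_zero] at this
    linarith [P.R_nonneg]
  · exact contDiffAt_const

theorem continuous_F : Continuous P.F := by
  refine continuous_matrix fun a b => ?_
  simp only [F_apply]
  exact continuous_finsetSum _ fun i _ => (P.smooth i).continuous.mul (continuous_piece i a b)

theorem contDiffAt_F {x : E3} (hx : x ∈ D.Gamᶜ) (a b : Fin 2) :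
    ContDiffAt ℝ ((⊤ : ℕ∞) : WithTop ℕ∞) (fun y => P.F y a b) x := by
  simp only [F_apply]
  refine ContDiffAt.sum fun i _ => P.contDiffAt_mul le_rfl fun hi => ?_
  obtain ⟨h1, h2⟩ := harmonic_coef P hi hx
  exact (h1.smooth.mul contDiffAt_const).add (h2.smooth.mul contDiffAt_const)

/-- Each active piece is a positive combination of squares of two independent linear forms, hence
definite; some piece is active at every point. -/
theorem posDef_F {x : E3} (hx : x ∈ D.Gamᶜ) : (P.F x).PosDef := by
  refine Matrix.PosDef.of_dotProduct_mulVec_pos ?_ fun v hv => ?_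
  · ext a b
    rw [Matrix.conjTranspose_apply, star_trivial, F_apply, F_apply]
    exact Finset.sum_congr rfl fun i _ => by unfold piece; ring
  · have e : star v ⬝ᵥ P.F x *ᵥ v = ∑ i, P.χ i x *
        (D.upCoef i x * (perp (D.lowDir i) 0 * v 0 + perp (D.lowDir i) 1 * v 1) ^ 2 +
          D.lowCoef i x * (perp (D.upDir i) 0 * v 0 + perp (D.upDir i) 1 * v 1) ^ 2) := by
      simp only [Matrix.mulVec, dotProduct, Fin.sum_univ_two, star_trivial, F_apply,
        Pi.star_apply, Finset.sum_mul, Finset.mul_sum, ← Finset.sum_add_distrib, piece]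
      exact Finset.sum_congr rfl fun i _ => by ring
    rw [e]
    have hterm : ∀ i, P.χ i x ≠ 0 → 0 <
        D.upCoef i x * (perp (D.lowDir i) 0 * v 0 + perp (D.lowDir i) 1 * v 1) ^ 2 +
          D.lowCoef i x * (perp (D.upDir i) 0 * v 0 + perp (D.upDir i) 1 * v 1) ^ 2 := by
      intro i hi
      obtain ⟨h1, h2⟩ := harmonic_coef P (P.mem_region_of_ne hi) hx
      have g := h1.pos
      have h := h2.pos
      have hdet := D.det_dir_ne_zero i
      by_contra hc
      have z1 : (perp (D.lowDir i) 0 * v 0 + perp (D.lowDir i) 1 * v 1) ^ 2 = 0 := by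
        by_contra hne
        have := mul_pos g ((sq_nonneg _).lt_of_ne' hne)
        have := mul_nonneg h.le (sq_nonneg (perp (D.upDir i) 0 * v 0 + perp (D.upDir i) 1 * v 1))
        linarith
      have z2 : (perp (D.upDir i) 0 * v 0 + perp (D.upDir i) 1 * v 1) ^ 2 = 0 := by
        by_contra hne
        have := mul_pos h ((sq_nonneg _).lt_of_ne' hne)
        have := mul_nonneg g.le (sq_nonneg (perp (D.lowDir i) 0 * v 0 + perp (D.lowDir i) 1 * v 1))
        linarith
      have w1 := pow_eq_zero_iff two_ne_zero |>.1 z1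
      have w2 := pow_eq_zero_iff two_ne_zero |>.1 z2
      simp only [perp, Matrix.cons_val_zero, Matrix.cons_val_one] at w1 w2
      apply hv
      have v0 : v 0 = 0 := by
        apply (mul_eq_zero.1 (?_ : (D.upDir i 0 * D.lowDir i 1 - D.upDir i 1 * D.lowDir i 0) * v 0
          = 0)).resolve_left hdet
        linear_combination (-D.upDir i 0) * w1 + D.lowDir i 0 * w2
      have v1 : v 1 = 0 := by
        apply (mul_eq_zero.1 (?_ : (D.upDir i 0 * D.lowDir i 1 - D.upDir i 1 * D.lowDir i 0) * v 1
          = 0)).resolve_left hdet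
        linear_combination (-D.upDir i 1) * w1 + D.lowDir i 1 * w2
      ext a; fin_cases a <;> simp [v0, v1]
    obtain ⟨i, hi⟩ := P.exists_pos x
    refine Finset.sum_pos' (fun j _ => ?_) ⟨i, Finset.mem_univ _, mul_pos hi (hterm i hi.ne')⟩
    by_cases hj : P.χ j x = 0
    · simp [hj]
    · exact mul_nonneg (P.nonneg j x) (hterm j hj).le

end Cutoffs

end RodData

/-! ### The parametrization, and continuity of the tension norm. -/

theorem det_param {F : Matrix (Fin 2) (Fin 2) ℝ} (hF : F.PosDef) (ω : Fin 2 → ℝ) :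
    (param F ω).det = 1 := by
  have hd := hF.det_pos.ne'
  have hs : F 1 0 = F 0 1 := by simpa using (hF.isHermitian.apply 0 1)
  have hdet : F.det = F 0 0 * F 1 1 - F 0 1 * F 0 1 := by rw [Matrix.det_fin_two, hs]
  rw [param, Matrix.det_fin_three]
  generalize F.det = f at *
  simp
  field_simp
  linear_combination (-f ^ 2) * hdet

theorem posDef_param {F : Matrix (Fin 2) (Fin 2) ℝ} (hF : F.PosDef) (ω : Fin 2 → ℝ) :
    (param F ω).PosDef := by
  have hd := hF.det_pos
  have hs : F 1 0 = F 0 1 := by simpa using (hF.isHermitian.apply 0 1)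
  refine Matrix.PosDef.of_dotProduct_mulVec_pos ?_ fun v hv => ?_
  · ext i j
    fin_cases i <;> fin_cases j <;> simp [param]
  -- Completing the square splits the form into its first variable, shifted by `ω`, and `F`.
  · have e : star v ⬝ᵥ param F ω *ᵥ v = F.det⁻¹ * (v 0 - ω 0 * v 1 - ω 1 * v 2) ^ 2 +
        star ![v 1, v 2] ⬝ᵥ F *ᵥ ![v 1, v 2] := by
      simp [param, Matrix.mulVec, dotProduct, Fin.sum_univ_three, Fin.sum_univ_two, hs]
      ring
    rw [e]
    by_cases hw : (![v 1, v 2] : Fin 2 → ℝ) = 0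
    · have h1 : v 1 = 0 := congrFun hw 0
      have h2 : v 2 = 0 := congrFun hw 1
      have h0 : v 0 ≠ 0 := fun h0 => hv (by ext i; fin_cases i <;> simp [h0, h1, h2])
      rw [hw, h1, h2]
      simp
      positivity
    · have := hF.dotProduct_mulVec_pos hw
      positivity

theorem contDiffAt_param {n : WithTop ℕ∞} {F : E3 → Matrix (Fin 2) (Fin 2) ℝ} {ω : E3 → Fin 2 → ℝ}
    {x : E3} (hF : ∀ a b, ContDiffAt ℝ n (fun y => F y a b) x)
    (hω : ∀ a, ContDiffAt ℝ n (fun y => ω y a) x) (hd : (F x).det ≠ 0) (i j : Fin 3) :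
    ContDiffAt ℝ n (fun y => param (F y) (ω y) i j) x := by
  have h1 : ContDiffAt ℝ n (fun y => (F y).det) x := by
    simp only [Matrix.det_fin_two]
    exact ((hF 0 0).mul (hF 1 1)).sub ((hF 0 1).mul (hF 1 0))
  have h2 := h1.inv hd
  have w0 := hω 0
  have w1 := hω 1
  have f00 := hF 0 0
  have f01 := hF 0 1
  have f11 := hF 1 1
  fin_cases i <;> fin_cases j <;> simp [param] <;> fun_prop

theorem continuousAt_tensionNorm {Φ : E3 → Matrix (Fin 3) (Fin 3) ℝ} {x : E3} (h : C2At Φ x)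
    (hd : ∀ᶠ y in 𝓝 x, (Φ y).det = 1) : ContinuousAt (tensionNorm Φ) x := by
  have c0 : ContinuousAt Φ x :=
    continuousAt_pi.2 fun i => continuousAt_pi.2 fun j => (h i j).continuousAt
  have c1 : ∀ k, ContinuousAt (pderiv k Φ) x := fun k =>
    continuousAt_pi.2 fun i => continuousAt_pi.2 fun j =>
      ((h i j).partial_deriv (m := 1) (by norm_num)).continuousAt
  have c2 : ∀ k, ContinuousAt (pderiv k (pderiv k Φ)) x := fun k =>
    continuousAt_pi.2 fun i => continuousAt_pi.2 fun j =>
      (((h i j).partial_deriv (m := 1) (by norm_num)).partial_deriv (m := 0)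
        (by norm_num)).continuousAt
  have ci : ContinuousAt (fun y => (Φ y)⁻¹) x := by
    -- With determinant one the inverse is the adjugate, which is polynomial in the entries.
    have ha : ContinuousAt (fun y => (Φ y).adjugate) x :=
      (Continuous.matrix_adjugate continuous_id).continuousAt.comp c0
    refine ha.congr ?_
    filter_upwards [hd] with y hy
    rw [Matrix.inv_def, hy]; simp
  have ct : ContinuousAt (tension Φ) x := by
    unfold tension christoffel
    refine tendsto_finsetSum _ fun k _ => ?_
    have m := ((c1 k).mul ci).mul (c1 k)
    exact (c2 k).add ((m.add m).const_smul (1 / 2 : ℝ)).neg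
  have cm : ContinuousAt (fun y => metric (Φ y) (tension Φ y) (tension Φ y)) x :=
    (continuous_id.matrix_trace.continuousAt).comp (((ci.mul ct).mul ci).mul ct)
  exact Real.continuous_sqrt.continuousAt.comp cm

namespace RodData

variable {D : RodData} (P : D.Cutoffs)

/-! ### Behaviour at the axis rods -/

/-- By `cone_mul` the vanishing coefficient is `ρ² / (4 cone (-s) t)`. Expanding `ξ = α v + β v^⊥`
gives `p`, `q` and a correction to `r`; the pairing of `ξ` with `v` makes `α ≠ 0`, so `p` is
positive. -/
theorem exists_adapted {v ξ : Fin 2 → ℝ} (hv : v ≠ 0) (hξ : ξ 0 * v 0 + ξ 1 * v 1 ≠ 0) {s t : ℝ}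
    (hs : s ^ 2 = 1) {x : E3} (hx : x ≠ axisPt t) (hc : 0 < cone (-s) t x) {h : E3 → ℝ}
    (hh : ContDiffAt ℝ 2 h x) (h0 : 0 < h x) :
    ∃ p q r : E3 → ℝ, ContDiffAt ℝ 2 p x ∧ ContDiffAt ℝ 2 q x ∧ ContDiffAt ℝ 2 r x ∧ 0 < p x ∧
      0 < r x ∧ ∀ᶠ y in 𝓝 x, ∀ a b, cone s t y * (ξ a * ξ b) + h y * (perp v a * perp v b) =
        rsq y * p y * (v a * v b) + rsq y * q y * (v a * perp v b + perp v a * v b) +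
          r y * (perp v a * perp v b) := by
  have hN := sq_add_sq_ne_zero hv
  set N := v 0 * v 0 + v 1 * v 1 with hN'
  set α := (ξ 0 * v 0 + ξ 1 * v 1) / N with hα
  set β := (ξ 1 * v 0 - ξ 0 * v 1) / N with hβ
  have e0 : ξ 0 = α * v 0 - β * v 1 := by rw [hα, hβ]; field_simp; rw [hN']; ring
  have e1 : ξ 1 = α * v 1 + β * v 0 := by rw [hα, hβ]; field_simp; rw [hN']; ring
  have eξ : ∀ a, ξ a = α * v a + β * perp v a := fun a => by
    fin_cases a
    · simp [perp, e0]; ring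
    · simp [perp, e1]
  have sg : ContDiffAt ℝ 2 (fun y => (4 * cone (-s) t y)⁻¹) x :=
    (contDiffAt_const.mul (contDiffAt_cone hx)).inv (by positivity)
  refine ⟨fun y => (4 * cone (-s) t y)⁻¹ * α ^ 2, fun y => (4 * cone (-s) t y)⁻¹ * (α * β),
    fun y => h y + rsq y * ((4 * cone (-s) t y)⁻¹ * β ^ 2), sg.mul contDiffAt_const,
    sg.mul contDiffAt_const, hh.add (contDiff_rsq.contDiffAt.mul (sg.mul contDiffAt_const)), ?_, ?_,
    ?_⟩
  · have : α ≠ 0 := div_ne_zero hξ hN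
    positivity
  · have := rsq_nonneg x
    positivity
  · filter_upwards [(continuous_cone (-s) t).continuousAt.eventually (lt_mem_nhds hc)]
      with y hy a b
    have hcy : cone s t y = rsq y * (4 * cone (-s) t y)⁻¹ := by
      rw [← div_eq_mul_inv, eq_div_iff (by positivity)]
      linear_combination 4 * cone_mul hs t y
    rw [hcy, eξ a, eξ b]
    ring

theorem exists_adapted_piece {i : Option (Fin D.L)} {x : E3} (hi : x ∈ D.region P.R i)
    (hr : rsq x = 0) {l : Fin (D.L + 1)} (hl : D.IsAxis l) (ht : x 2 ∈ D.openRod l) :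
    ∃ p q r : E3 → ℝ, ContDiffAt ℝ 2 p x ∧ ContDiffAt ℝ 2 q x ∧ ContDiffAt ℝ 2 r x ∧ 0 < p x ∧
      0 < r x ∧ ∀ᶠ y in 𝓝 x, ∀ a b, D.piece i y a b =
        rsq y * p y * (D.dir l a * D.dir l b) +
          rsq y * q y * (D.dir l a * perp (D.dir l) b + perp (D.dir l) a * D.dir l b) +
          r y * (perp (D.dir l) a * perp (D.dir l) b) := by
  have hi' : axisPt (x 2) ∈ D.region P.R i := by rwa [← eq_axisPt_of_rsq hr]
  have hdet := D.det_dir_ne_zero i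
  have hv := D.dir_ne_zero hl
  rcases openRod_of_mem_region P hi' ht with ⟨rfl, h⟩ | ⟨rfl, h⟩
  · have hx : x ≠ axisPt (D.height i) := fun h0 => h.ne' ((eq_axisPt_iff _ _).1 h0).2
    have hc : 0 < cone (-1) (D.height i) x := cone_pos_of_height (by linarith)
    have hu : D.upDir i = D.dir (D.upRod i) := by rw [upDir, if_pos hl]
    have hsm : ContDiffAt ℝ 2 (D.lowCoef i) x ∧ 0 < D.lowCoef i x := by
      unfold lowCoef
      split_ifs
      · exact ⟨contDiffAt_cone hx, hc⟩
      · exact ⟨contDiffAt_const, one_pos⟩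
    have hξ : perp (D.lowDir i) 0 * D.dir (D.upRod i) 0 +
        perp (D.lowDir i) 1 * D.dir (D.upRod i) 1 ≠ 0 := by
      rw [← hu]
      intro h0
      apply hdet
      simp [perp] at h0
      linarith
    obtain ⟨p, q, r, h1, h2, h3, h4, h5, h6⟩ := exists_adapted hv hξ (s := 1) (by norm_num) hx hc
      hsm.1 hsm.2
    refine ⟨p, q, r, h1, h2, h3, h4, h5, ?_⟩
    filter_upwards [h6] with y hy a b
    rw [← hy, piece, upCoef, if_pos hl, hu]
  · have hx : x ≠ axisPt (D.height i) := fun h0 => h.ne ((eq_axisPt_iff _ _).1 h0).2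
    have hc : 0 < cone (- -1) (D.height i) x := cone_pos_of_height (by linarith)
    have hu : D.lowDir i = D.dir (D.lowRod i) := by rw [lowDir, if_pos hl]
    have hsm : ContDiffAt ℝ 2 (D.upCoef i) x ∧ 0 < D.upCoef i x := by
      unfold upCoef
      split_ifs
      · exact ⟨contDiffAt_cone hx, by simpa using hc⟩
      · exact ⟨contDiffAt_const, one_pos⟩
    have hξ : perp (D.upDir i) 0 * D.dir (D.lowRod i) 0 +
        perp (D.upDir i) 1 * D.dir (D.lowRod i) 1 ≠ 0 := by
      rw [← hu]
      intro h0
      apply hdet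
      simp [perp] at h0
      linarith
    obtain ⟨p, q, r, h1, h2, h3, h4, h5, h6⟩ := exists_adapted hv hξ (s := -1) (by norm_num) hx hc
      hsm.1 hsm.2
    refine ⟨p, q, r, h1, h2, h3, h4, h5, ?_⟩
    filter_upwards [h6] with y hy a b
    rw [← hy, piece, lowCoef, if_pos hl, hu]
    ring

/-- The end vectors square to the standard projections. -/
theorem ends_sq (D : RodData) :
    ((D.dir 0 0 * D.dir 0 0 = 1 ∧ D.dir 0 1 = 0) ∧ D.dir (Fin.last D.L) 0 = 0 ∧
      D.dir (Fin.last D.L) 1 * D.dir (Fin.last D.L) 1 = 1) ∨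
    ((D.dir 0 0 = 0 ∧ D.dir 0 1 * D.dir 0 1 = 1) ∧
      D.dir (Fin.last D.L) 0 * D.dir (Fin.last D.L) 0 = 1 ∧ D.dir (Fin.last D.L) 1 = 0) := by
  have sq : ∀ k : ℤ, |k| = 1 → (k : ℝ) * k = 1 := fun k hk => by
    have : k * k = 1 := by rw [← abs_mul_abs_self, hk]; norm_num
    exact_mod_cast this
  rcases D.ends with ⟨h1, h2, h3, h4⟩ | ⟨h1, h2, h3, h4⟩
  · left
    simp [dir, h2, h3, sq _ h1, sq _ h4]
  · right
    simp [dir, h1, h4, sq _ h2, sq _ h3]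

namespace Cutoffs

/-- All active pieces are adapted to the same vector `D.dir l`, and the adapted shape is linear in
`(p, q, r)`; thus it survives the sum, with `p` and `r` positive because one cutoff is. -/
theorem exists_adaptedAt {x : E3} (hr : rsq x = 0) {l : Fin (D.L + 1)} (hl : D.IsAxis l)
    (ht : x 2 ∈ D.openRod l) :
    ∃ p q r, AdaptedAt (D.dir l) P.F x p q r ∧ 0 < p x ∧ 0 < r x := by
  have key : ∀ i, ∃ p q r : E3 → ℝ, ContDiffAt ℝ 2 p x ∧ ContDiffAt ℝ 2 q x ∧ ContDiffAt ℝ 2 r x ∧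
      0 ≤ p x ∧ 0 ≤ r x ∧ (0 < P.χ i x → 0 < p x ∧ 0 < r x) ∧
      ∀ᶠ y in 𝓝 x, ∀ a b, P.χ i y * D.piece i y a b =
        rsq y * p y * (D.dir l a * D.dir l b) +
          rsq y * q y * (D.dir l a * perp (D.dir l) b + perp (D.dir l) a * D.dir l b) +
          r y * (perp (D.dir l) a * perp (D.dir l) b) := by
    intro i
    by_cases hx : x ∈ tsupport (P.χ i)
    · obtain ⟨p, q, r, h1, h2, h3, h4, h5, h6⟩ := exists_adapted_piece P (P.supp i hx) hr hl ht
      have hχ : ContDiffAt ℝ 2 (P.χ i) x := ((P.smooth i).of_le two_le_infty).contDiffAt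
      refine ⟨fun y => P.χ i y * p y, fun y => P.χ i y * q y, fun y => P.χ i y * r y, hχ.mul h1,
        hχ.mul h2, hχ.mul h3, mul_nonneg (P.nonneg i x) h4.le, mul_nonneg (P.nonneg i x) h5.le,
        fun h => ⟨mul_pos h h4, mul_pos h h5⟩, ?_⟩
      filter_upwards [h6] with y hy a b
      rw [hy]; ring
    · have h0 := notMem_tsupport_iff_eventuallyEq.1 hx
      refine ⟨fun _ => 0, fun _ => 0, fun _ => 0, contDiffAt_const, contDiffAt_const,
        contDiffAt_const, le_rfl, le_rfl, fun h => absurd h (by simp [h0.eq_of_nhds]), ?_⟩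
      filter_upwards [h0] with y hy a b
      simp [hy]
  choose p q r h1 h2 h3 h4 h5 h6 h7 using key
  obtain ⟨i, hi⟩ := P.exists_pos x
  refine ⟨fun y => ∑ i, p i y, fun y => ∑ i, q i y, fun y => ∑ i, r i y,
    ⟨ContDiffAt.sum fun i _ => h1 i, ContDiffAt.sum fun i _ => h2 i,
      ContDiffAt.sum fun i _ => h3 i, ?_⟩,
    Finset.sum_pos' (fun j _ => h4 j) ⟨i, Finset.mem_univ _, (h6 i hi).1⟩,
    Finset.sum_pos' (fun j _ => h5 j) ⟨i, Finset.mem_univ _, (h6 i hi).2⟩⟩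
  filter_upwards [Filter.eventually_all.2 h7] with y hy a b
  rw [F_apply, Finset.sum_congr rfl fun i _ => hy i a b]
  simp only [Finset.sum_add_distrib, Finset.mul_sum, Finset.sum_mul]

theorem potential_eventuallyEq {i : Option (Fin D.L)} {t : ℝ} (hi : axisPt t ∈ D.region P.R i)
    {l : Fin (D.L + 1)} (hl : D.IsAxis l) (ht : t ∈ D.rod l) :
    ∀ᶠ y in 𝓝 (axisPt t), D.potential i y = D.c l := by
  have hcase := rod_of_mem_region P hi ht
  rcases i with _ | i
  · have hn : ‖axisPt t‖ = |t| := by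
      rw [← abs_norm, ← sq_eq_sq_iff_abs_eq_abs, norm_sq_eq]; simp
    have h : 0 < |t| := by rw [← hn]; exact P.R_nonneg.trans_lt hi
    have h0 : axisPt t ≠ 0 := fun h0 => by rw [h0, norm_zero] at hn; linarith
    have hang : ang (axisPt t) = t / |t| := by rw [ang, hn, axisPt_two]
    have hca : ContinuousAt ang (axisPt t) := (contDiffAt_ang (n := 0) h0).continuousAt
    rcases hcase with ⟨rfl, h1⟩ | ⟨rfl, h1⟩
    · have h1' : 0 < t := lt_of_le_of_ne h1 (fun h => by simp [← h] at *)
      have : 1 / 2 < ang (axisPt t) := by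
        rw [hang, abs_of_pos h1', div_self h1'.ne']; norm_num
      filter_upwards [hca.eventually (lt_mem_nhds this)] with y hy
      funext a
      simp only [potential, angFun, step_of_ge hy.le, upRod]
      ring
    · have h1' : t < 0 := lt_of_le_of_ne h1 (fun h => by simp [h] at *)
      have : ang (axisPt t) < -(1 / 2) := by
        rw [hang, abs_of_neg h1', div_neg, div_self h1'.ne]; norm_num
      filter_upwards [hca.eventually (gt_mem_nhds this)] with y hy
      funext a
      simp only [potential, angFun, step_of_le hy.le, lowRod]
      ring
  · refine Filter.Eventually.of_forall fun y => ?_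
    rcases hcase with ⟨rfl, -⟩ | ⟨rfl, -⟩
    · exact if_pos hl
    · by_cases hu : D.IsAxis i.castSucc
      · exact (if_pos hu).trans (D.corner_const i hu hl)
      · exact if_neg hu

/-- Every piece contributing near the point has the same constant potential there, and the cutoffs
sum to one. Constancy on a whole neighbourhood is what the local tension estimates need. -/
theorem ω_eventuallyEq {t : ℝ} {l : Fin (D.L + 1)} (hl : D.IsAxis l) (ht : t ∈ D.rod l) :
    ∀ᶠ y in 𝓝 (axisPt t), P.ω y = D.c l := by
  have key : ∀ i, ∀ᶠ y in 𝓝 (axisPt t), ∀ a, P.χ i y * D.potential i y a = P.χ i y * D.c l a := by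
    intro i
    by_cases hx : axisPt t ∈ tsupport (P.χ i)
    · filter_upwards [P.potential_eventuallyEq (P.supp i hx) hl ht] with y hy a
      rw [hy]
    · filter_upwards [notMem_tsupport_iff_eventuallyEq.1 hx] with y hy a
      simp [hy]
  filter_upwards [Filter.eventually_all.2 key] with y hy
  funext a
  rw [ω, Finset.sum_congr rfl fun i _ => hy i a, ← Finset.sum_mul, P.sum_eq, one_mul]

theorem F_mulVec_dir {t : ℝ} {l : Fin (D.L + 1)} (hl : D.IsAxis l) (ht : t ∈ D.rod l) :
    P.F (axisPt t) *ᵥ D.dir l = 0 := by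
  funext a
  have key : ∀ i, P.χ i (axisPt t) * (D.piece i (axisPt t) a 0 * D.dir l 0 +
      D.piece i (axisPt t) a 1 * D.dir l 1) = 0 := by
    intro i
    by_cases hi : P.χ i (axisPt t) = 0
    · rw [hi, zero_mul]
    · rcases rod_of_mem_region P (P.mem_region_of_ne hi) ht with ⟨rfl, h⟩ | ⟨rfl, h⟩
      · have h1 : D.upCoef i (axisPt t) = 0 := by
          rw [upCoef, if_pos hl, cone_axis (by norm_num) (by linarith)]
        have h2 : D.upDir i = D.dir (D.upRod i) := by rw [upDir, if_pos hl]
        rw [← h2]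
        simp only [piece, h1, perp, Matrix.cons_val_zero, Matrix.cons_val_one]
        ring
      · have h1 : D.lowCoef i (axisPt t) = 0 := by
          rw [lowCoef, if_pos hl, cone_axis (by norm_num) (by linarith)]
        have h2 : D.lowDir i = D.dir (D.lowRod i) := by rw [lowDir, if_pos hl]
        rw [← h2]
        simp only [piece, h1, perp, Matrix.cons_val_zero, Matrix.cons_val_one]
        ring
  simp only [Matrix.mulVec, dotProduct, Fin.sum_univ_two, F_apply, Finset.sum_mul,
    ← Finset.sum_add_distrib, Pi.zero_apply]
  exact Finset.sum_eq_zero fun i _ => by rw [← key i]; ring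

theorem ker_F {t : ℝ} {l : Fin (D.L + 1)} (hl : D.IsAxis l) (ht : t ∈ D.openRod l) (w : Fin 2 → ℝ)
    (hw : P.F (axisPt t) *ᵥ w = 0) : ∃ s : ℝ, w = s • D.dir l := by
  have hr : rsq (axisPt t) = 0 := by simp [rsq]
  obtain ⟨p, q, r, hA, -, hpos⟩ := P.exists_adaptedAt hr hl (by simpa using ht)
  have hF := hA.eq.self_of_nhds
  rw [hr] at hF
  have hN := sq_add_sq_ne_zero (D.dir_ne_zero hl)
  have h0 := congrFun hw 0
  have h1 := congrFun hw 1
  simp only [Matrix.mulVec, dotProduct, Fin.sum_univ_two, hF, perp, Matrix.cons_val_zero,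
    Matrix.cons_val_one, Pi.zero_apply] at h0 h1
  set v := D.dir l with hv
  -- On the axis only the `r` term of the adapted shape remains, a positive multiple of the
  -- projection onto the perpendicular of `v`; so a kernel vector is parallel to `v`.
  have hz : v 0 * w 1 - v 1 * w 0 = 0 := by
    have : (r (axisPt t) * (v 0 * v 0 + v 1 * v 1)) * (v 0 * w 1 - v 1 * w 0) = 0 := by
      linear_combination (-v 1) * h0 + v 0 * h1
    exact (mul_eq_zero.1 this).resolve_left (mul_ne_zero hpos.ne' hN)
  refine ⟨(v 0 * w 0 + v 1 * w 1) / (v 0 * v 0 + v 1 * v 1), ?_⟩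
  ext a
  fin_cases a
  · simp only [Fin.zero_eta, Pi.smul_apply, smul_eq_mul]
    rw [div_mul_eq_mul_div, eq_div_iff hN]
    linear_combination (-v 1) * hz
  · simp only [Fin.mk_one, Pi.smul_apply, smul_eq_mul]
    rw [div_mul_eq_mul_div, eq_div_iff hN]
    linear_combination v 0 * hz

theorem respects : D.Respects P.F P.ω :=
  ⟨P.continuous_F, continuous_pi fun a => (P.contDiff_ω a).continuous, fun _ hl =>
    ⟨fun _ ht => ⟨P.F_mulVec_dir hl ht, (P.ω_eventuallyEq hl ht).self_of_nhds⟩,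
      fun _ ht w hw => P.ker_F hl ht w hw⟩⟩

/-! ### The asymptotic region -/

theorem χ_of_large {x : E3} (hx : P.R + 1 ≤ ‖x‖) :
    P.χ none x = 1 ∧ ∀ i, P.χ (some i) x = 0 := by
  have h : ∀ i, P.χ (some i) x = 0 := fun i => by
    by_contra hne
    exact absurd (P.mem_region_of_ne hne).1 (not_lt.2 hx)
  have hs := P.sum_eq x
  rw [Fintype.sum_option] at hs
  simp only [h, Finset.sum_const_zero, add_zero] at hs
  exact ⟨hs, h⟩

theorem F_of_large {x : E3} (hx : P.R + 1 ≤ ‖x‖) (a b : Fin 2) : P.F x a b =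
    cone 1 0 x * (perp (D.dir (Fin.last D.L)) a * perp (D.dir (Fin.last D.L)) b) +
      cone (-1) 0 x * (perp (D.dir 0) a * perp (D.dir 0) b) := by
  obtain ⟨h1, h2⟩ := P.χ_of_large hx
  rw [F_apply, Fintype.sum_option]
  simp only [h1, h2, zero_mul, Finset.sum_const_zero, add_zero, one_mul]
  have hu : D.IsAxis (D.upRod none) := D.isAxis_zero
  have hl : D.IsAxis (D.lowRod none) := D.isAxis_last
  rw [piece, upCoef, lowCoef, upDir, lowDir, if_pos hu, if_pos hl, if_pos hu, if_pos hl]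
  rfl

theorem ω_of_large {x : E3} (hx : P.R + 1 ≤ ‖x‖) (a : Fin 2) :
    P.ω x a = angFun (D.c (Fin.last D.L) a) (D.c 0 a - D.c (Fin.last D.L) a) x := by
  obtain ⟨h1, h2⟩ := P.χ_of_large hx
  rw [ω, Fintype.sum_option]
  simp only [h1, h2, zero_mul, Finset.sum_const_zero, add_zero, one_mul, potential]

theorem F_eq_minkowski {x : E3} (hx : P.R + 1 ≤ ‖x‖) : P.F x = D.minkowski x := by
  ext a b
  rw [P.F_of_large hx, minkowski, cone_zero_eq, cone_zero_eq]
  simp only [Matrix.add_apply, Matrix.smul_apply, Matrix.vecMulVec_apply, smul_eq_mul]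
  rcases D.ends_sq with ⟨⟨h1, h2⟩, h3, h4⟩ | ⟨⟨h1, h2⟩, h3, h4⟩ <;>
    fin_cases a <;> fin_cases b <;> simp [perp, h1, h2, h3, h4]

theorem rsq_ne_zero_of_large {x : E3} (hx : x ∈ D.Gamᶜ) (h : P.R < ‖x‖) : rsq x ≠ 0 := by
  intro hr
  obtain ⟨l, hl, ht⟩ := exists_of_notMem_gam hx hr
  have hi : axisPt (x 2) ∈ D.region P.R none := by rw [← eq_axisPt_of_rsq hr]; exact h
  rcases openRod_of_mem_region P hi ht with ⟨rfl, -⟩ | ⟨rfl, -⟩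
  · exact hl D.isAxis_zero
  · exact hl D.isAxis_last

theorem exists_decay : ∃ C : ℝ, 0 ≤ C ∧ ∀ x ∈ D.Gamᶜ, P.R + 2 ≤ ‖x‖ →
    tensionNorm P.Φ x ≤ C * ‖x‖ ^ (-(7 / 2) : ℝ) := by
  obtain ⟨C, hC, h⟩ := exists_tensionNorm_decay (D.c (Fin.last D.L))
    fun a => D.c 0 a - D.c (Fin.last D.L) a
  refine ⟨C, hC, fun x hx hR => ?_⟩
  have hr := P.rsq_ne_zero_of_large hx (by linarith)
  -- The margin between `R + 2` and `R + 1` makes the asymptotic formulas valid on a neighbourhood,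
  -- as differentiation requires.
  have hev : ∀ᶠ y in 𝓝 x, P.R + 1 ≤ ‖y‖ :=
    (continuous_norm.continuousAt.eventually (lt_mem_nhds (show P.R + 1 < ‖x‖ by linarith))).mono
      fun y hy => hy.le
  have hω : ∀ᶠ y in 𝓝 x, ∀ i, P.ω y i =
      angFun (D.c (Fin.last D.L) i) (D.c 0 i - D.c (Fin.last D.L) i) y :=
    hev.mono fun y hy i => P.ω_of_large hy i
  have h1 : 1 ≤ ‖x‖ := by linarith [P.R_nonneg]
  rcases D.ends_sq with ⟨⟨h2, h3⟩, h4, h5⟩ | ⟨⟨h2, h3⟩, h4, h5⟩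
  · refine h 1 (by norm_num) P.F P.ω x hr h1 (hev.mono fun y hy => ?_) hω
    ext a b
    rw [P.F_of_large hy]
    fin_cases a <;> fin_cases b <;> simp [perp, h2, h3, h4, h5]
  · refine h (-1) (by norm_num) P.F P.ω x hr h1 (hev.mono fun y hy => ?_) hω
    ext a b
    rw [P.F_of_large hy]
    fin_cases a <;> fin_cases b <;> simp [perp, h2, h3, h4, h5]

/-! ### Bounded tension -/

theorem Φ_smooth {x : E3} (hx : x ∈ D.Gamᶜ) (i j : Fin 3) :
    ContDiffAt ℝ ((⊤ : ℕ∞) : WithTop ℕ∞) (fun y => P.Φ y i j) x :=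
  contDiffAt_param (P.contDiffAt_F hx) (fun a => (P.contDiff_ω a).contDiffAt)
    (P.posDef_F hx).det_pos.ne' i j

theorem bounded_off_gam {x : E3} (hx : x ∈ D.Gamᶜ) :
    ∃ C : ℝ, ∀ᶠ y in 𝓝 x, y ∈ D.Gamᶜ → tensionNorm P.Φ y ≤ C := by
  have hdet : ∀ᶠ y in 𝓝 x, (P.Φ y).det = 1 := by
    filter_upwards [D.isClosed_gam.isOpen_compl.mem_nhds hx] with y hy
    exact det_param (P.posDef_F hy) _
  have hc := continuousAt_tensionNorm
    (fun i j => (P.Φ_smooth hx i j).of_le two_le_infty) hdet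
  exact ⟨tensionNorm P.Φ x + 1, (hc.eventually (gt_mem_nhds (lt_add_one _))).mono
    fun y hy _ => hy.le⟩

theorem bounded_on_rod {x : E3} (hr : rsq x = 0) {l : Fin (D.L + 1)} (hl : D.IsAxis l)
    (ht : x 2 ∈ D.openRod l) :
    ∃ C : ℝ, ∀ᶠ y in 𝓝 x, y ∈ D.Gamᶜ → tensionNorm P.Φ y ≤ C := by
  obtain ⟨p, q, r, hA, hp, hs⟩ := P.exists_adaptedAt hr hl ht
  have hω := P.ω_eventuallyEq hl (D.openRod_subset_rod l ht)
  rw [← eq_axisPt_of_rsq hr] at hω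
  obtain ⟨C, hC⟩ := hA.eventually_tensionNorm_le (D.dir_ne_zero hl) hω hr hp hs
  refine ⟨C, ?_⟩
  have hcoord : Continuous fun y : E3 => y 2 := (contDiff_coord (n := 0) 2).continuous
  filter_upwards [hC, hcoord.continuousAt.eventually ((D.isOpen_openRod l).mem_nhds ht)]
    with y h1 h2 hy
  refine h1 fun h0 => ?_
  obtain ⟨l', hl', ht'⟩ := exists_of_notMem_gam hy h0
  exact hl' (D.openRod_disjoint h2 ht' ▸ hl)

/-- No region other than that of `z i` contains this point, so near it the map is a single harmonic
piece with constant potential, and the tension vanishes off `Γ`. -/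
theorem bounded_at_z (i : Fin D.L) :
    ∃ C : ℝ, ∀ᶠ y in 𝓝 (axisPt (D.z i)), y ∈ D.Gamᶜ → tensionNorm P.Φ y ≤ C := by
  have hreg : ∀ j, axisPt (D.z i) ∈ D.region P.R j → j = some i := by
    intro j hj
    rcases j with _ | j
    · exfalso
      have hn : ‖axisPt (D.z i)‖ = |D.z i| := by
        rw [← abs_norm, ← sq_eq_sq_iff_abs_eq_abs, norm_sq_eq]; simp
      have : P.R < ‖axisPt (D.z i)‖ := hj
      rw [hn] at this
      exact absurd (P.le_R i) (not_le.2 this)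
    · obtain ⟨-, h1, h2⟩ := hj
      simp only [axisPt_two] at h1 h2
      rcases lt_trichotomy j i with h | h | h
      · exact absurd (h2 i h) (lt_irrefl _)
      · rw [h]
      · exact absurd (h1 i h) (lt_irrefl _)
  have hmem : axisPt (D.z i) ∈ D.region P.R (some i) := by
    obtain ⟨j, hj⟩ := D.exists_mem_region P.R (axisPt (D.z i))
    rwa [hreg j hj] at hj
  have hzero : ∀ᶠ y in 𝓝 (axisPt (D.z i)), ∀ j, j ≠ some i → P.χ j y = 0 := by
    refine Filter.eventually_all.2 fun j => ?_
    by_cases hj : j = some i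
    · exact Filter.Eventually.of_forall fun y h => absurd hj h
    · filter_upwards [notMem_tsupport_iff_eventuallyEq.1 fun h => hj (hreg j (P.supp j h))]
        with y hy _
      exact hy
  have hF : ∀ᶠ y in 𝓝 (axisPt (D.z i)), ∀ a b, P.F y a b = D.piece (some i) y a b := by
    filter_upwards [hzero] with y hy a b
    have h1 : P.χ (some i) y = 1 := by
      rw [← P.sum_eq y, Finset.sum_eq_single (some i) (fun j _ hj => hy j hj) (by simp)]
    rw [F_apply, Finset.sum_eq_single (some i) (fun j _ hj => by rw [hy j hj, zero_mul]) (by simp),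
      h1, one_mul]
  -- At least one rod ending at `z i` is an axis rod; its closed rod contains `z i`, so `ω` is
  -- constant on a full neighbourhood, on both sides of the point.
  obtain ⟨l, hl, ht⟩ : ∃ l, D.IsAxis l ∧ D.z i ∈ D.rod l := by
    rcases D.corner_or_pole i with h | h
    · exact ⟨_, h, fun j hj => (D.z_strictAnti (by simpa using hj)).le,
        fun j hj => D.z_strictAnti.antitone (by simpa using hj)⟩
    · exact ⟨_, h, fun j hj => D.z_strictAnti.antitone (Fin.castSucc_lt_succ_iff.1 hj),
        fun j hj => (D.z_strictAnti (Fin.succ_le_castSucc_iff.1 hj)).le⟩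
  refine ⟨0, ?_⟩
  filter_upwards [hF.eventually_nhds, (P.ω_eventuallyEq hl ht).eventually_nhds,
    (D.isOpen_region P.R (some i)).mem_nhds hmem] with y h1 h2 h3 hy
  obtain ⟨hg, hh⟩ := harmonic_coef P h3 hy
  have hdet := D.det_dir_ne_zero (some i)
  refine (tensionNorm_param_eq_zero (ξ := perp (D.lowDir (some i))) (η := perp (D.upDir (some i)))
    ?_ h1 h2 (hg.smooth.of_le two_le_infty) (hh.smooth.of_le two_le_infty) hg.pos hh.pos hg.lap
    hh.lap).le
  intro h0
  apply hdet
  simp [perp] at h0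
  linarith

/-! ### From local to global bounds. -/

theorem locally_bounded (x : E3) :
    ∃ C : ℝ, ∀ᶠ y in 𝓝 x, y ∈ D.Gamᶜ → tensionNorm P.Φ y ≤ C := by
  by_cases hx : x ∈ D.Gam
  · obtain ⟨hr, ⟨i, rfl⟩ | ⟨l, hl, ht⟩⟩ := mem_gam_cases hx
    · exact P.bounded_at_z i
    · exact P.bounded_on_rod hr hl ht
  · exact P.bounded_off_gam hx

/-- The local bounds hold around every point of `K`, including those on `Γ`, where the tension
itself is not controlled; a finite subcover suffices. -/
theorem bounded_on_compact {K : Set E3} (hK : IsCompact K) :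
    ∃ C : ℝ, ∀ y ∈ K, y ∈ D.Gamᶜ → tensionNorm P.Φ y ≤ C := by
  refine hK.induction_on (p := fun s => ∃ C : ℝ, ∀ y ∈ s, y ∈ D.Gamᶜ → tensionNorm P.Φ y ≤ C)
    ⟨0, by simp⟩ (fun s t hst ⟨C, hC⟩ => ⟨C, fun y hy => hC y (hst hy)⟩) ?_ fun x _ => ?_
  · rintro s t ⟨C, hC⟩ ⟨C', hC'⟩
    refine ⟨max C C', fun y hy hyG => ?_⟩
    rcases hy with hy | hy
    · exact (hC y hy hyG).trans (le_max_left _ _)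
    · exact (hC' y hy hyG).trans (le_max_right _ _)
  · obtain ⟨C, hC⟩ := P.locally_bounded x
    exact ⟨_, mem_nhdsWithin_of_mem_nhds hC, C, fun y hy => hy⟩

theorem isModelMap : D.IsModelMap P.Φ :=
  ⟨fun i j _ hx => (P.Φ_smooth hx i j).contDiffWithinAt,
    fun _ hx => ⟨posDef_param (P.posDef_F hx) _, det_param (P.posDef_F hx) _⟩,
    P.F, P.ω, fun _ hx => ⟨P.posDef_F hx, rfl⟩, P.respects, P.R + 1, fun _ hx => P.F_eq_minkowski hx⟩

theorem exists_bound : ∃ C : ℝ, ∀ x ∈ D.Gamᶜ, tensionNorm P.Φ x ≤ C := by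
  obtain ⟨C, hC0, hC⟩ := P.exists_decay
  obtain ⟨C', hC'⟩ := P.bounded_on_compact (isCompact_closedBall (0 : E3) (P.R + 2))
  refine ⟨max C C', fun x hx => ?_⟩
  rcases le_total ‖x‖ (P.R + 2) with h | h
  · exact (hC' x (by simpa using h) hx).trans (le_max_right _ _)
  · refine ((hC x hx h).trans ?_).trans (le_max_left _ _)
    have : ‖x‖ ^ (-(7 / 2) : ℝ) ≤ 1 :=
      Real.rpow_le_one_of_one_le_of_nonpos (by linarith [P.R_nonneg]) (by norm_num)
    calc C * ‖x‖ ^ (-(7 / 2) : ℝ) ≤ C * 1 := by gcongr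
      _ = C := mul_one C

end Cutoffs

end RodData

end RodModel

end

/-- The construction glues explicit harmonic pieces by a partition of unity. Positive definite
matrices form a convex cone, and so do those with a prescribed kernel on an axis rod, so that no sign
condition on consecutive corners is needed: the generalized compatibility condition is not used. -/
theorem theorem5p1 (D : RodModel.RodData) (hD : D.GeneralizedCompatibility) :
    ∃ Φ : RodModel.E3 → Matrix (Fin 3) (Fin 3) ℝ,
      D.IsModelMap Φ ∧
      (∃ C : ℝ, ∀ x ∈ D.Gamᶜ, RodModel.tensionNorm Φ x ≤ C) ∧
      ∃ C R : ℝ, 0 < R ∧ ∀ x ∈ D.Gamᶜ, R ≤ ‖x‖ →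
        RodModel.tensionNorm Φ x ≤ C * ‖x‖ ^ (-(7 / 2) : ℝ) := by
  obtain ⟨P⟩ := D.nonempty_cutoffs
  obtain ⟨C, -, hC⟩ := P.exists_decay
  exact ⟨P.Φ, P.isModelMap, P.exists_bound, C, P.R + 2, by linarith [P.R_nonneg], hC⟩
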